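/- Let $K$ be a locally compact hypergroup: a locally compact Hausdorff space with an identity $e$, an involutive homeomorphism $x\mapsto x^-$, and an associative convolution of bounded Radon measures $\mu*\nu=\iint(\delta_x*\delta_y)\,d\mu(x)\,d\nu(y)$, such that every $\delta_x*\delta_y$ is a Radon probability measure with compact support, $(x,y)\mapsto\delta_x*\delta_y$ is weakly continuous, $(x,y)\mapsto\operatorname{supp}(\delta_x*\delta_y)$ is continuous for the Michael topology on non-empty compact sets, $\delta_e*\delta_x=\delta_x=\delta_x*\delta_e$, $(\delta_x*\delta_y)^-=\delta_{y^-}*\delta_{x^-}$, and $e\in\operatorname{supp}(\delta_x*\delta_y)$ if and only if $x=y^-$. Write $f(x*y):=\int_K f\,d(\delta_x*\delta_y)$. Let $\lambda$ be a left-invariant Radon measure on $K$ (i.e. $\delta_x*\lambda=\lambda$ for all $x\in K$), and let $w$ be a weight on $K$: a positive continuous function with $w(x*y)\le w(x)w(y)$ for all $x,y\in K$. Let $\Phi$ be a Young function (a convex even function $\mathbb R\to[0,\infty)$ with $\Phi(0)=0$ and $\lim_{x\to\infty}\Phi(x)=\infty$) whose complementary function $\Psi(x)=\sup\{y|x|-\Phi(y):y\ge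 0\}$ is also a (finite-valued) Young function, and suppose $\Psi\in\Delta_2$, i.e. there are $k>0$ and $t_0\ge 0$ with $\Psi(2t)\le k\Psi(t)$ for all $t\ge t_0$. Let $L^1_w(K)$ be the space of ($\lambda$-a.e. classes of) measurable $f:K\to\mathbb C$ with $\|f\|_{1,w}=\int_K|f|\,w\,d\lambda<\infty$, and let $L^\Phi_w(K)$ be the space of ($\lambda$-a.e. classes of) measurable $f$ with $\int_K\Phi(\alpha|fw|)\,d\lambda<\infty$ for some $\alpha>0$, equipped with $$\|f\|_{\Phi,w}=\sup\Big\{\int_K|f\,w\,v|\,d\lambda:\ v \text{ measurable},\ \int_K\Psi(|v|)\,d\lambda\le 1\Big\}.$$ Let $g\in C_c(K)$, let $(f*g)(x)=\int_K f(y)\,g(y^-*x)\,d\lambda(y)$, and let $L_xg:=\delta_x*g$, that is, $(L_xg)(y)=g(x^-*y)$. Then the convolution operator $T_g:L^1_w(K)\to L^\Phi_w(K)$, $f\mapsto f*g$, is (well defined and) compact if and only if the function $$F_g(x)=\frac{\|L_xg\|_{\Phi,w}}{w(x)}\qquad(x\in K)$$ vanishes at infinity. -/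

import Mathlib

open MeasureTheory Filter Topology
open scoped ENNReal

noncomputable section

/-! ### Locally compact hypergroups -/

/-- A locally compact hypergroup structure on a (locally compact Hausdorff) space `K` with its Borel
sets.  `mul x y` is the probability measure `δ_x * δ_y`.  The convolution of two bounded Radon
measures is `μ * ν = ∫∫ (δ_x * δ_y) dμ(x) dν(y)`; it is determined by its values on point masses. -/
structure Hypergroup (K : Type*) [TopologicalSpace K] [MeasurableSpace K]
    [OpensMeasurableSpace K] where
  /-- the convolution `δ_x * δ_y` of two point masses -/
  mul : K → K → ProbabilityMeasure K
  /-- the identity element -/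
  one : K
  /-- the involution, a homeomorphism -/
  inv : K ≃ₜ K
  mul_regular : ∀ x y, (mul x y : Measure K).Regular
  isCompact_support : ∀ x y, IsCompact (mul x y : Measure K).support
  /-- `(x, y) ↦ δ_x * δ_y` is continuous for the weak topology -/
  continuous_mul : Continuous fun p : K × K => mul p.1 p.2
  /-- `(x, y) ↦ supp (δ_x * δ_y)` is continuous for the Michael topology, tested on its subbasis -/
  continuous_support : ∀ U V : Set K, IsOpen U → IsOpen V →
    IsOpen {p : K × K | ((mul p.1 p.2 : Measure K).support ∩ U).Nonempty ∧
      (mul p.1 p.2 : Measure K).support ⊆ V}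
  /-- `(δ_x * δ_y) * δ_z = δ_x * (δ_y * δ_z)` -/
  mul_assoc : ∀ (x y z : K) (f : BoundedContinuousFunction K ℝ),
    ∫ t, (∫ s, f s ∂(mul t z : Measure K)) ∂(mul x y : Measure K) =
      ∫ t, (∫ s, f s ∂(mul x t : Measure K)) ∂(mul y z : Measure K)
  one_mul : ∀ x, (mul one x : Measure K) = Measure.dirac x
  mul_one : ∀ x, (mul x one : Measure K) = Measure.dirac x
  inv_inv : ∀ x, inv (inv x) = x
  /-- `(δ_x * δ_y)⁻ = δ_{y⁻} * δ_{x⁻}` -/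
  map_inv_mul : ∀ x y, (mul x y : Measure K).map inv = (mul (inv y) (inv x) : Measure K)
  one_mem_support_iff : ∀ x y, one ∈ (mul x y : Measure K).support ↔ x = inv y

namespace Hypergroup

variable {K : Type*} [TopologicalSpace K] [MeasurableSpace K] [OpensMeasurableSpace K]

/-- `f(x * y) = ∫ f d(δ_x * δ_y)`. -/
def ev {E : Type*} [NormedAddCommGroup E] [NormedSpace ℝ E] (H : Hypergroup K) (f : K → E)
    (x y : K) : E :=
  ∫ t, f t ∂(H.mul x y : Measure K)

/-- The left translate `L_x g = δ_x * g`, that is `(L_x g)(y) = g(x⁻ * y)`. -/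
def leftTranslate (H : Hypergroup K) (x : K) (g : K → ℂ) (y : K) : ℂ :=
  H.ev g (H.inv x) y

/-- Left invariance `δ_x * μ = μ` of a Radon measure: `∫ f(x * y) dμ(y) = ∫ f dμ` for `f ∈ C_c(K)`. -/
def IsLeftInvariant (H : Hypergroup K) (μ : Measure K) : Prop :=
  ∀ (x : K) (f : K → ℝ), Continuous f → HasCompactSupport f →
    ∫ y, H.ev f x y ∂μ = ∫ y, f y ∂μ

/-- The integral defining `(f * g)(x) = ∫ f(y) g(y⁻ * x) dμ(y)` exists. -/
def ConvExistsAt (H : Hypergroup K) (μ : Measure K) (f g : K → ℂ) (x : K) : Prop :=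
  Integrable (fun y => f y * H.ev g (H.inv y) x) μ

/-- `(f * g)(x) = ∫ f(y) g(y⁻ * x) dμ(y)`. -/
def conv (H : Hypergroup K) (μ : Measure K) (f g : K → ℂ) (x : K) : ℂ :=
  ∫ y, f y * H.ev g (H.inv y) x ∂μ

/-- A weight: a positive continuous function with `w(x * y) ≤ w(x) w(y)`. -/
structure IsWeight (H : Hypergroup K) (w : C(K, ℝ)) : Prop where
  pos : ∀ x, 0 < w x
  ev_le : ∀ x y, H.ev w x y ≤ w x * w y

end Hypergroup

/-! ### Young functions -/

/-- A Young function: convex, even, `[0, ∞)`-valued, `Φ 0 = 0`, `Φ x → ∞` as `x → ∞`. -/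
structure IsYoungFunction (Φ : ℝ → ℝ) : Prop where
  convex : ConvexOn ℝ Set.univ Φ
  even : ∀ x, Φ (-x) = Φ x
  nonneg : ∀ x, 0 ≤ Φ x
  zero : Φ 0 = 0
  tendsto : Tendsto Φ atTop atTop

/-- A pair of Young functions, the second being the complementary function
`Ψ(x) = sup {y|x| - Φ(y) : y ≥ 0}` of the first. -/
structure YoungPair where
  Φ : ℝ → ℝ
  Ψ : ℝ → ℝ
  young_Φ : IsYoungFunction Φ
  young_Ψ : IsYoungFunction Ψ
  complementary : ∀ x, IsLUB {s : ℝ | ∃ y, 0 ≤ y ∧ s = y * |x| - Φ y} (Ψ x)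

/-- `Δ₂`-regularity. -/
def DeltaTwo (Φ : ℝ → ℝ) : Prop :=
  ∃ k : ℝ, 0 < k ∧ ∃ t₀ : ℝ, 0 ≤ t₀ ∧ ∀ t, t₀ ≤ t → Φ (2 * t) ≤ k * Φ t

theorem IsYoungFunction.mono {Φ : ℝ → ℝ} (h : IsYoungFunction Φ) {a b : ℝ} (ha : 0 ≤ a)
    (hab : a ≤ b) : Φ a ≤ Φ b := by
  rcases eq_or_lt_of_le (ha.trans hab) with hb | hb
  · have : a = b := by linarith
    rw [this]
  · have hc := h.convex.2 (Set.mem_univ b) (Set.mem_univ 0)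
      (show 0 ≤ a / b by positivity)
      (show 0 ≤ 1 - a / b by rw [sub_nonneg, div_le_one hb]; exact hab) (by ring)
    simp only [smul_eq_mul, mul_zero, add_zero, h.zero] at hc
    rw [div_mul_cancel₀ _ hb.ne'] at hc
    refine hc.trans (mul_le_of_le_one_left (h.nonneg b) ?_)
    rw [div_le_one hb]; exact hab

theorem IsYoungFunction.measurable {Φ : ℝ → ℝ} (h : IsYoungFunction Φ) : Measurable Φ := by
  have : Continuous Φ := continuousOn_univ.1 (h.convex.continuousOn isOpen_univ)
  exact this.measurable

/-! ### Orlicz spaces -/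

section Orlicz

variable {K : Type*} [MeasurableSpace K]

/-- The Orlicz norm `‖f‖_Φ = sup {∫ |f v| dμ : ∫ Ψ(|v|) dμ ≤ 1}`, as an extended number. -/
def orliczNorm (P : YoungPair) (μ : Measure K) (f : K → ℂ) : ℝ≥0∞ :=
  ⨆ (v : K → ℂ) (_ : Measurable v) (_ : ∫⁻ x, ENNReal.ofReal (P.Ψ ‖v x‖) ∂μ ≤ 1),
    ∫⁻ x, ‖f x * v x‖ₑ ∂μ

/-- `∫ Φ(α|f|) dμ < ∞` for some `α > 0`. -/
def OrliczFinite (P : YoungPair) (μ : Measure K) (f : K → ℂ) : Prop :=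
  ∃ α : ℝ, 0 < α ∧ ∫⁻ x, ENNReal.ofReal (P.Φ (α * ‖f x‖)) ∂μ < ∞

theorem OrliczFinite.add {P : YoungPair} {μ : Measure K} {f g : K → ℂ}
    (hfm : AEStronglyMeasurable f μ) (hf : OrliczFinite P μ f) (hg : OrliczFinite P μ g) :
    OrliczFinite P μ (fun x => f x + g x) := by
  obtain ⟨α, hα, hf⟩ := hf
  obtain ⟨β, hβ, hg⟩ := hg
  refine ⟨min α β / 2, by positivity, ?_⟩
  have key : ∀ x, ENNReal.ofReal (P.Φ (min α β / 2 * ‖f x + g x‖)) ≤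
      ENNReal.ofReal (P.Φ (α * ‖f x‖)) + ENNReal.ofReal (P.Φ (β * ‖g x‖)) := by
    intro x
    rw [← ENNReal.ofReal_add (P.young_Φ.nonneg _) (P.young_Φ.nonneg _)]
    refine ENNReal.ofReal_le_ofReal ?_
    have h1 : min α β / 2 * ‖f x + g x‖ ≤ (1 / 2 : ℝ) * (α * ‖f x‖) + (1 / 2) * (β * ‖g x‖) := by
      have h2 := norm_add_le (f x) (g x)
      have h3 := mul_le_mul_of_nonneg_right (min_le_left α β) (norm_nonneg (f x))
      have h4 := mul_le_mul_of_nonneg_right (min_le_right α β) (norm_nonneg (g x))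
      have h5 := mul_le_mul_of_nonneg_left h2 (le_min hα.le hβ.le)
      linarith
    have h6 := P.young_Φ.mono (by positivity) h1
    have h7 := P.young_Φ.convex.2 (Set.mem_univ (α * ‖f x‖)) (Set.mem_univ (β * ‖g x‖))
      (show (0 : ℝ) ≤ 1 / 2 by norm_num) (show (0 : ℝ) ≤ 1 / 2 by norm_num) (by norm_num)
    simp only [smul_eq_mul] at h7
    have h8 := P.young_Φ.nonneg (α * ‖f x‖)
    have h9 := P.young_Φ.nonneg (β * ‖g x‖)
    linarith
  refine (lintegral_mono key).trans_lt ?_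
  rw [lintegral_add_left']
  · exact ENNReal.add_lt_top.2 ⟨hf, hg⟩
  · exact (P.young_Φ.measurable.comp_aemeasurable
      (hfm.norm.aemeasurable.const_mul α)).ennreal_ofReal

theorem OrliczFinite.const_mul {P : YoungPair} {μ : Measure K} {f : K → ℂ} (c : ℂ)
    (hf : OrliczFinite P μ f) : OrliczFinite P μ (fun x => c * f x) := by
  obtain ⟨α, hα, hf⟩ := hf
  refine ⟨α / (‖c‖ + 1), by positivity, (lintegral_mono fun x => ?_).trans_lt hf⟩
  refine ENNReal.ofReal_le_ofReal (P.young_Φ.mono (by positivity) ?_)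
  rw [norm_mul, div_mul_eq_mul_div, div_le_iff₀ (by positivity)]
  nlinarith [mul_nonneg hα.le (norm_nonneg (f x))]

theorem OrliczFinite.congr_ae {P : YoungPair} {μ : Measure K} {f g : K → ℂ} (h : f =ᵐ[μ] g)
    (hf : OrliczFinite P μ f) : OrliczFinite P μ g := by
  obtain ⟨α, hα, hf⟩ := hf
  refine ⟨α, hα, ?_⟩
  rw [lintegral_congr_ae (g := fun x => ENNReal.ofReal (P.Φ (α * ‖f x‖)))]
  · exact hf
  · filter_upwards [h] with x hx
    rw [hx]

theorem orliczNorm_congr_ae {P : YoungPair} {μ : Measure K} {f g : K → ℂ} (h : f =ᵐ[μ] g) :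
    orliczNorm P μ f = orliczNorm P μ g := by
  unfold orliczNorm
  refine iSup_congr fun v => iSup_congr fun _ => iSup_congr fun _ => lintegral_congr_ae ?_
  filter_upwards [h] with x hx
  rw [hx]

theorem orliczNorm_lt_top {P : YoungPair} {μ : Measure K} {f : K → ℂ} (hf : OrliczFinite P μ f) :
    orliczNorm P μ f < ∞ := by
  obtain ⟨α, hα, hf⟩ := hf
  have hbound : orliczNorm P μ f ≤ ENNReal.ofReal α⁻¹ *
      (∫⁻ x, ENNReal.ofReal (P.Φ (α * ‖f x‖)) ∂μ + 1) := by
    refine iSup_le fun v => iSup_le fun hv => iSup_le fun hv1 => ?_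
    have key : ∀ x, ‖f x * v x‖ₑ ≤ ENNReal.ofReal α⁻¹ *
        (ENNReal.ofReal (P.Φ (α * ‖f x‖)) + ENNReal.ofReal (P.Ψ ‖v x‖)) := by
      intro x
      rw [← ENNReal.ofReal_add (P.young_Φ.nonneg _) (P.young_Ψ.nonneg _),
        ← ENNReal.ofReal_mul (by positivity), ← ofReal_norm, norm_mul]
      refine ENNReal.ofReal_le_ofReal ?_
      have h1 := (P.complementary ‖v x‖).1 ⟨α * ‖f x‖, by positivity, rfl⟩
      rw [abs_of_nonneg (norm_nonneg _)] at h1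
      have h2 : α * (‖f x‖ * ‖v x‖) ≤ P.Φ (α * ‖f x‖) + P.Ψ ‖v x‖ := by linarith
      rw [inv_mul_eq_div, le_div_iff₀ hα]
      linarith
    refine (lintegral_mono key).trans ?_
    rw [lintegral_const_mul' _ _ ENNReal.ofReal_ne_top, lintegral_add_right _
      (by exact (P.young_Ψ.measurable.comp hv.norm).ennreal_ofReal)]
    gcongr
  exact hbound.trans_lt (ENNReal.mul_lt_top ENNReal.ofReal_lt_top
    (ENNReal.add_lt_top.2 ⟨hf, ENNReal.one_lt_top⟩))

theorem orliczNorm_add_le {P : YoungPair} {μ : Measure K} {f g : K → ℂ}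
    (hf : AEStronglyMeasurable f μ) :
    orliczNorm P μ (fun x => f x + g x) ≤ orliczNorm P μ f + orliczNorm P μ g := by
  refine iSup_le fun v => iSup_le fun hv => iSup_le fun hv1 => ?_
  calc ∫⁻ x, ‖(f x + g x) * v x‖ₑ ∂μ ≤ ∫⁻ x, (‖f x * v x‖ₑ + ‖g x * v x‖ₑ) ∂μ := by
        refine lintegral_mono fun x => ?_
        rw [add_mul]
        exact enorm_add_le _ _
    _ = ∫⁻ x, ‖f x * v x‖ₑ ∂μ + ∫⁻ x, ‖g x * v x‖ₑ ∂μ :=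
        lintegral_add_left' (hf.mul hv.aestronglyMeasurable).enorm _
    _ ≤ _ := by
        refine add_le_add ?_ ?_
        · exact le_iSup_of_le v (le_iSup_of_le hv (le_iSup_of_le hv1 le_rfl))
        · exact le_iSup_of_le v (le_iSup_of_le hv (le_iSup_of_le hv1 le_rfl))

theorem orliczNorm_const_mul {P : YoungPair} {μ : Measure K} {f : K → ℂ} (c : ℂ) :
    orliczNorm P μ (fun x => c * f x) = ‖c‖ₑ * orliczNorm P μ f := by
  unfold orliczNorm
  simp_rw [ENNReal.mul_iSup]
  refine iSup_congr fun v => iSup_congr fun _ => iSup_congr fun _ => ?_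
  rw [← lintegral_const_mul' _ _ enorm_ne_top]
  refine lintegral_congr fun x => ?_
  rw [mul_assoc, enorm_mul]

end Orlicz

/-! ### Weighted spaces -/

section Weighted

variable {K : Type*} [TopologicalSpace K] [MeasurableSpace K] [OpensMeasurableSpace K]

/-- `L¹_w(K)` with `‖f‖_{1,w} = ∫ |f| w dμ`, as the `L¹` space of the measure `w μ`. -/
abbrev WeightedL1 (μ : Measure K) (w : C(K, ℝ)) : Type _ :=
  Lp ℂ 1 (μ.withDensity fun x => ENNReal.ofReal (w x))

/-- The subspace of classes (modulo equality `μ`-a.e.) of measurable `f` with `w f ∈ L^Φ`. -/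
def orliczSubmodule (P : YoungPair) (μ : Measure K) (w : C(K, ℝ)) : Submodule ℂ (K →ₘ[μ] ℂ) where
  carrier := {f | OrliczFinite P μ fun x => (w x : ℂ) * f x}
  zero_mem' := by
    refine OrliczFinite.congr_ae (f := fun _ => 0) ?_ ⟨1, one_pos, by simp [P.young_Φ.zero]⟩
    filter_upwards [AEEqFun.coeFn_zero (μ := μ) (β := ℂ) (α := K)] with x hx
    simp [hx]
  add_mem' := by
    intro f g hf hg
    refine OrliczFinite.congr_ae ?_ (OrliczFinite.add ?_ hf hg)
    · filter_upwards [AEEqFun.coeFn_add f g] with x hx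
      simp [hx, mul_add]
    · exact (Complex.continuous_ofReal.measurable.comp
        w.continuous.measurable).aestronglyMeasurable.mul f.aestronglyMeasurable
  smul_mem' := by
    intro c f hf
    refine OrliczFinite.congr_ae ?_ (OrliczFinite.const_mul c hf)
    filter_upwards [AEEqFun.coeFn_smul c f] with x hx
    simp [hx]
    ring

/-- The weighted Orlicz space `L^Φ_w(K)`; its norm is `‖f‖_{Φ,w} = ‖w f‖_Φ`. -/
def OrliczSpace (P : YoungPair) (μ : Measure K) (w : C(K, ℝ)) : Type _ :=
  orliczSubmodule P μ w

namespace OrliczSpace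

variable {P : YoungPair} {μ : Measure K} {w : C(K, ℝ)}

instance : AddCommGroup (OrliczSpace P μ w) :=
  inferInstanceAs (AddCommGroup (orliczSubmodule P μ w))

instance : Module ℂ (OrliczSpace P μ w) :=
  inferInstanceAs (Module ℂ (orliczSubmodule P μ w))

/-- A representative of an element of `L^Φ_w(K)`. -/
def rep (f : OrliczSpace P μ w) : K → ℂ := (f.1 : K →ₘ[μ] ℂ)

theorem finite (f : OrliczSpace P μ w) : OrliczFinite P μ fun x => (w x : ℂ) * f.rep x := f.2

theorem aesm (f : OrliczSpace P μ w) :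
    AEStronglyMeasurable (fun x => (w x : ℂ) * f.rep x) μ :=
  (Complex.continuous_ofReal.measurable.comp
    w.continuous.measurable).aestronglyMeasurable.mul f.1.aestronglyMeasurable

theorem rep_zero : (0 : OrliczSpace P μ w).rep =ᵐ[μ] 0 := AEEqFun.coeFn_zero

theorem rep_add (f g : OrliczSpace P μ w) : (f + g).rep =ᵐ[μ] f.rep + g.rep :=
  AEEqFun.coeFn_add _ _

theorem rep_smul (c : ℂ) (f : OrliczSpace P μ w) : (c • f).rep =ᵐ[μ] c • f.rep :=
  AEEqFun.coeFn_smul _ _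

/-- The extended norm of an element of `L^Φ_w(K)`; it is finite. -/
def enorm' (f : OrliczSpace P μ w) : ℝ≥0∞ := orliczNorm P μ fun x => (w x : ℂ) * f.rep x

theorem enorm'_ne_top (f : OrliczSpace P μ w) : f.enorm' ≠ ∞ := (orliczNorm_lt_top f.finite).ne

theorem enorm'_zero : (0 : OrliczSpace P μ w).enorm' = 0 := by
  have h : (fun x => (w x : ℂ) * (0 : OrliczSpace P μ w).rep x) =ᵐ[μ] fun _ => 0 := by
    filter_upwards [rep_zero (P := P) (μ := μ) (w := w)] with x hx
    simp [hx]
  rw [enorm', orliczNorm_congr_ae h]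
  simp [orliczNorm]

theorem enorm'_add (f g : OrliczSpace P μ w) : (f + g).enorm' ≤ f.enorm' + g.enorm' := by
  have h : (fun x => (w x : ℂ) * (f + g).rep x) =ᵐ[μ]
      fun x => (w x : ℂ) * f.rep x + (w x : ℂ) * g.rep x := by
    filter_upwards [rep_add f g] with x hx
    simp [hx, mul_add]
  rw [enorm', orliczNorm_congr_ae h]
  exact orliczNorm_add_le f.aesm

theorem enorm'_smul (c : ℂ) (f : OrliczSpace P μ w) : (c • f).enorm' = ‖c‖ₑ * f.enorm' := by
  have h : (fun x => (w x : ℂ) * (c • f).rep x) =ᵐ[μ] fun x => c * ((w x : ℂ) * f.rep x) := by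
    filter_upwards [rep_smul c f] with x hx
    simp [hx]
    ring
  rw [enorm', orliczNorm_congr_ae h, orliczNorm_const_mul]
  rfl

instance : SeminormedAddCommGroup (OrliczSpace P μ w) :=
  AddGroupSeminorm.toSeminormedAddCommGroup
    { toFun := fun f => f.enorm'.toReal
      map_zero' := by simp [enorm'_zero]
      add_le' := fun f g => by
        rw [← ENNReal.toReal_add f.enorm'_ne_top g.enorm'_ne_top]
        exact ENNReal.toReal_mono (ENNReal.add_ne_top.2 ⟨f.enorm'_ne_top, g.enorm'_ne_top⟩)
          (enorm'_add f g)
      neg' := fun f => by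
        have h := enorm'_smul (-1 : ℂ) f
        rw [neg_one_smul] at h
        rw [h]
        simp }

theorem norm_def (f : OrliczSpace P μ w) :
    ‖f‖ = (orliczNorm P μ fun x => (w x : ℂ) * f.rep x).toReal := rfl

instance : NormedSpace ℂ (OrliczSpace P μ w) where
  norm_smul_le c f := by
    change (c • f).enorm'.toReal ≤ ‖c‖ * f.enorm'.toReal
    rw [enorm'_smul, ENNReal.toReal_mul, toReal_enorm]

end OrliczSpace

end Weighted

end

/-!
Write `k(y, x) = w(x) (L_y g)(x) / w(y)`. Then `w (f * g) = ∫ (w f)(y) k(y, ·) dλ(y)`, where `w f`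
ranges over `L¹(λ)`, and `F_g(y) = ‖k(y, ·)‖_Φ`. The theorem is thus a statement about an integral
operator `L¹ → L^Φ` with kernel `k`. Two facts about hypergroups enter.

* `k` is jointly continuous, and its support is proper over both factors
  (`Hypergroup.isProperKernel_weightedKernel`). This comes from the reciprocity
  `z ∈ supp (δ_{y⁻} * δ_x) ↔ x ∈ supp (δ_y * δ_z)` (`Hypergroup.mem_supp_inv_left_iff`) and from
  the compactness of products of compact sets (`Hypergroup.isCompact_iUnion_supp`).
* A non-zero left-invariant measure charges all non-empty open sets
  (`Hypergroup.IsLeftInvariant.isOpenPosMeasure`).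

If `F_g` vanishes at infinity, it is bounded, and Minkowski's inequality
(`IsProperKernel.orliczNorm_integral_le`) makes the operator bounded. Over a compact set of `y`
the map `y ↦ k(y, ·)` is uniformly close to a step function, so the operator is nearly of finite
rank there (`IsProperKernel.exists_finite_rank_approx`), while the part over the complement has
norm at most the supremum of `F_g` on it. Hence the image of the unit ball is totally bounded.

Conversely, if the operator is compact, convolving with normalized indicators of small
neighbourhoods of `y` shows that `L_y g / w(y)` lies in the closure of the image of the unit ball
(`Hypergroup.normalizedTranslate_mem_closure`), which is contained in a compact set. A limit along
an ultrafilter tending to infinity has norm zero, since `L_y g` vanishes on any given compact set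
for `y` far away.

The measure `λ` is not assumed σ-finite and `K × K` may carry more Borel sets than the product
σ-algebra, so Fubini's theorem is not available; Riemann sums and the Fatou property of the Orlicz
norm are used instead. For the same reason `L^Φ_w` need not be separated, and compactness is
obtained inside its subspace of σ-finitely supported elements, which is complete
(`OrliczSpace.completeSpace_sigmaFinitePart`) and contains all `f * g`.
-/

noncomputable section

/-! ### Supports of convolutions in a hypergroup -/

namespace Hypergroup

variable {K : Type*} [TopologicalSpace K] [MeasurableSpace K]

/-- The support of `δ_x * δ_y`. -/
def supp [OpensMeasurableSpace K] (H : Hypergroup K) (x y : K) : Set K :=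
  (H.mul x y : Measure K).support

theorem supp_mem_ae [OpensMeasurableSpace K] (H : Hypergroup K) (x y : K) :
    H.supp x y ∈ ae (H.mul x y : Measure K) :=
  haveI := H.mul_regular x y
  Measure.support_mem_ae_of_regular

theorem supp_nonempty [OpensMeasurableSpace K] (H : Hypergroup K) (x y : K) :
    (H.supp x y).Nonempty :=
  nonempty_of_mem (H.supp_mem_ae x y)

theorem isOpen_setOf_supp_subset [OpensMeasurableSpace K] (H : Hypergroup K) {V : Set K}
    (hV : IsOpen V) : IsOpen {p : K × K | H.supp p.1 p.2 ⊆ V} := by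
  have h := H.continuous_support Set.univ V isOpen_univ hV
  convert h using 3 with p
  exact ⟨fun h => ⟨by simpa [supp] using H.supp_nonempty p.1 p.2, h⟩, fun h => h.2⟩

/-- The product `A * B = ⋃ supp (δ_x * δ_y)` of compact sets is compact. -/
theorem isCompact_iUnion_supp [OpensMeasurableSpace K] (H : Hypergroup K) {C : Set (K × K)}
    (hC : IsCompact C) : IsCompact (⋃ p ∈ C, H.supp p.1 p.2) := by
  classical
  refine isCompact_of_finite_subcover fun {ι} U hU hcov => ?_
  have h1 : ∀ p ∈ C, ∃ t : Finset ι, H.supp p.1 p.2 ⊆ ⋃ i ∈ t, U i := fun p hp =>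
    (H.isCompact_support p.1 p.2).elim_finite_subcover U hU
      ((Set.subset_biUnion_of_mem (u := fun p : K × K => H.supp p.1 p.2) hp).trans hcov)
  choose! t ht using h1
  obtain ⟨s, hsC, hs⟩ := hC.elim_nhds_subcover
    (fun p => {q : K × K | H.supp q.1 q.2 ⊆ ⋃ i ∈ t p, U i})
    fun p hp => (H.isOpen_setOf_supp_subset (isOpen_biUnion fun i _ => hU i)).mem_nhds (ht p hp)
  refine ⟨s.biUnion t, Set.iUnion₂_subset fun p hp => ?_⟩
  obtain ⟨q, hq, hpq⟩ := Set.mem_iUnion₂.1 (hs hp)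
  refine Set.Subset.trans hpq (Set.iUnion₂_subset fun i hi => ?_)
  exact Set.subset_biUnion_of_mem (u := U) (Finset.mem_coe.2 (Finset.mem_biUnion.2 ⟨q, hq, hi⟩))

theorem continuous_integral_mul [OpensMeasurableSpace K] {𝕜 : Type*} [RCLike 𝕜]
    (H : Hypergroup K) (f : BoundedContinuousFunction K 𝕜) :
    Continuous fun p : K × K => ∫ t, f t ∂(H.mul p.1 p.2 : Measure K) := by
  rw [continuous_iff_continuousAt]
  intro p
  exact (ProbabilityMeasure.tendsto_iff_forall_integral_rclike_tendsto 𝕜).1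
    (H.continuous_mul.tendsto p) f

theorem integral_eq_zero_of_supp [OpensMeasurableSpace K] {E : Type*} [NormedAddCommGroup E]
    [NormedSpace ℝ E] (H : Hypergroup K) {f : K → E} {x y : K} (hf : ∀ t ∈ H.supp x y, f t = 0) :
    ∫ t, f t ∂(H.mul x y : Measure K) = 0 :=
  integral_eq_zero_of_ae (mem_of_superset (H.supp_mem_ae x y) hf)

theorem integral_pos_of_supp [OpensMeasurableSpace K] (H : Hypergroup K) {f : K → ℝ}
    (hfc : Continuous f) {M : ℝ} (hM : ∀ t, f t ≤ M) (hf0 : ∀ t, 0 ≤ f t) {x y s : K}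
    (hs : s ∈ H.supp x y) (hfs : 0 < f s) : 0 < ∫ t, f t ∂(H.mul x y : Measure K) := by
  have hint : Integrable f (H.mul x y : Measure K) :=
    Integrable.of_bound hfc.measurable.aestronglyMeasurable M
      (ae_of_all _ fun t => by rw [Real.norm_of_nonneg (hf0 t)]; exact hM t)
  rw [integral_pos_iff_support_of_nonneg hf0 hint]
  refine (Measure.mem_support_iff_forall s).1 hs _ ?_
  exact hfc.isOpen_support.mem_nhds hfs.ne'

/-- If `e ∈ supp (δ_{q₁ t} * δ_{q₂ t})` exactly for `t = s`, then `s ∈ supp (δ_a * δ_b)` if and only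
if the mixture of the `δ_{q₁ t} * δ_{q₂ t}` over `δ_a * δ_b` has `e` in its support, as tested on
non-negative functions. -/
theorem mem_supp_iff_forall_integral_pos [T2Space K] [LocallyCompactSpace K] [BorelSpace K]
    (H : Hypergroup K) {q : K → K × K} (hq : Continuous q) {s : K}
    (hqs : ∀ t, H.one ∈ H.supp (q t).1 (q t).2 ↔ t = s) (a b : K) :
    s ∈ H.supp a b ↔ ∀ f : BoundedContinuousFunction K ℝ, (∀ x, 0 ≤ f x) → 0 < f H.one →
      0 < ∫ t, (∫ u, f u ∂(H.mul (q t).1 (q t).2 : Measure K)) ∂(H.mul a b : Measure K) := by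
  constructor
  · intro hs f hf0 hf1
    refine H.integral_pos_of_supp (M := ‖f‖) ((H.continuous_integral_mul f).comp hq) (fun t => ?_)
      (fun t => integral_nonneg hf0) hs ?_
    · refine (le_abs_self _).trans ((norm_integral_le_of_norm_le_const (C := ‖f‖)
        (ae_of_all _ fun u => f.norm_coe_le_norm u)).trans (by simp))
    · exact H.integral_pos_of_supp (M := ‖f‖) f.continuous
        (fun t => (le_abs_self _).trans (f.norm_coe_le_norm t)) hf0 ((hqs s).2 rfl) hf1
  · intro h
    by_contra hs
    have hC := H.isCompact_iUnion_supp ((H.isCompact_support a b).image hq)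
    set C := ⋃ p ∈ q '' (H.mul a b : Measure K).support, H.supp p.1 p.2
    have h1 : H.one ∉ C := by
      intro h1
      obtain ⟨_, ⟨t, ht, rfl⟩, h2⟩ := Set.mem_iUnion₂.1 h1
      exact hs ((hqs t).1 h2 ▸ ht)
    obtain ⟨f, hf1, hfC, -, hf01⟩ := exists_continuous_one_zero_of_isCompact
      (isCompact_singleton (x := H.one)) hC.isClosed (Set.disjoint_singleton_left.2 h1)
    let F : BoundedContinuousFunction K ℝ := BoundedContinuousFunction.mkOfBound f 1 fun x y => by
      rw [Real.dist_eq, abs_le]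
      constructor <;> linarith [(hf01 x).1, (hf01 x).2, (hf01 y).1, (hf01 y).2]
    have h2 := h F (fun x => (hf01 x).1) (by
      change 0 < f H.one
      rw [hf1 rfl]; exact one_pos)
    refine h2.ne' (H.integral_eq_zero_of_supp fun t ht => H.integral_eq_zero_of_supp fun u hu => ?_)
    exact hfC (Set.mem_iUnion₂.2 ⟨q t, ⟨t, ht, rfl⟩, hu⟩)

theorem inv_mem_supp_iff [T2Space K] [LocallyCompactSpace K] [BorelSpace K]
    (H : Hypergroup K) (x y z : K) :
    H.inv z ∈ H.supp (H.inv y) (H.inv x) ↔ z ∈ H.supp x y := by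
  unfold supp
  rw [← H.map_inv_mul, Measure.mem_support_iff_forall, Measure.mem_support_iff_forall]
  have h : ∀ U, ((H.mul x y : Measure K).map H.inv) U = (H.mul x y : Measure K) (H.inv ⁻¹' U) :=
    fun U => H.inv.toMeasurableEquiv.map_apply U
  constructor
  · intro h1 U hU
    have h2 := h1 (H.inv '' U) (H.inv.isOpenMap.image_mem_nhds hU)
    rwa [h, Set.preimage_image_eq _ H.inv.injective] at h2
  · intro h1 U hU
    rw [h]
    exact h1 _ (H.inv.continuous.continuousAt hU)

/-- The reciprocity `z ∈ supp (δ_{y⁻} * δ_x) ↔ x ∈ supp (δ_y * δ_z)`: both sides say that `e` lies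
in the support of `δ_{z⁻} * δ_{y⁻} * δ_x`, bracketed in the two possible ways. -/
theorem mem_supp_inv_left_iff [T2Space K] [LocallyCompactSpace K] [BorelSpace K]
    (H : Hypergroup K) (x y z : K) : z ∈ H.supp (H.inv y) x ↔ x ∈ H.supp y z := by
  have h1 := H.mem_supp_iff_forall_integral_pos (q := fun t => (H.inv z, t)) (s := z)
    (by fun_prop) (fun t => (H.one_mem_support_iff _ _).trans
      ⟨fun h => (H.inv.injective h).symm, fun h => by rw [h]⟩) (H.inv y) x
  have h2 := H.mem_supp_iff_forall_integral_pos (q := fun t => (t, x)) (s := H.inv x)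
    (by fun_prop) (fun t => H.one_mem_support_iff _ _) (H.inv z) (H.inv y)
  rw [h1, ← H.inv_mem_supp_iff y z x, h2]
  refine forall_congr' fun f => ?_
  simp only [H.mul_assoc]

theorem mem_supp_inv_right_iff [T2Space K] [LocallyCompactSpace K] [BorelSpace K]
    (H : Hypergroup K) (x y z : K) : x ∈ H.supp z (H.inv y) ↔ z ∈ H.supp x y := by
  rw [← H.inv_mem_supp_iff z, H.inv_inv, ← H.inv_mem_supp_iff x y z, ← H.mem_supp_inv_left_iff]

/-! ### Translates of functions with compact support -/

theorem continuous_ev [OpensMeasurableSpace K] [R1Space K] {𝕜 : Type*} [RCLike 𝕜] (H : Hypergroup K)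
    {f : K → 𝕜} (hf : Continuous f) (hfc : HasCompactSupport f) :
    Continuous fun p : K × K => H.ev f p.1 p.2 := by
  obtain ⟨M, hM⟩ := hfc.exists_bound_of_continuous hf
  exact H.continuous_integral_mul (BoundedContinuousFunction.ofNormedAddCommGroup f hf M hM)

theorem exists_mem_supp_of_ev_ne_zero [OpensMeasurableSpace K] {E : Type*} [NormedAddCommGroup E]
    [NormedSpace ℝ E] (H : Hypergroup K) {f : K → E} {x y : K} (h : H.ev f x y ≠ 0) :
    ∃ z ∈ tsupport f, z ∈ H.supp x y := by
  by_contra! h1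
  exact h (H.integral_eq_zero_of_supp fun t ht => by
    by_contra h2
    exact h1 t (subset_tsupport f h2) ht)

theorem exists_isCompact_leftTranslate_eq_zero [T2Space K] [LocallyCompactSpace K] [BorelSpace K]
    (H : Hypergroup K) {g : K → ℂ} (hgc : HasCompactSupport g) {C : Set K} (hC : IsCompact C) :
    ∃ D, IsCompact D ∧ ∀ y ∈ C, ∀ x ∉ D, H.leftTranslate y g x = 0 := by
  refine ⟨_, H.isCompact_iUnion_supp (hC.prod hgc), fun y hy x hx => ?_⟩
  by_contra h
  obtain ⟨z, hz, hzs⟩ := H.exists_mem_supp_of_ev_ne_zero h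
  exact hx (Set.mem_iUnion₂.2 ⟨(y, z), ⟨hy, hz⟩, (H.mem_supp_inv_left_iff x y z).1 hzs⟩)

theorem exists_isCompact_leftTranslate_eq_zero' [T2Space K] [LocallyCompactSpace K] [BorelSpace K]
    (H : Hypergroup K) {g : K → ℂ} (hgc : HasCompactSupport g) {D : Set K} (hD : IsCompact D) :
    ∃ C, IsCompact C ∧ ∀ x ∈ D, ∀ y ∉ C, H.leftTranslate y g x = 0 := by
  refine ⟨_, H.isCompact_iUnion_supp (hD.prod (hgc.image H.inv.continuous)),
    fun x hx y hy => ?_⟩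
  by_contra h
  obtain ⟨z, hz, hzs⟩ := H.exists_mem_supp_of_ev_ne_zero h
  refine hy (Set.mem_iUnion₂.2 ⟨(x, H.inv z), ⟨hx, ⟨z, hz, rfl⟩⟩, ?_⟩)
  rw [H.mem_supp_inv_right_iff, ← H.mem_supp_inv_left_iff]
  exact hzs

/-- A non-zero left-invariant measure charges every non-empty open set. -/
theorem IsLeftInvariant.isOpenPosMeasure [T2Space K] [LocallyCompactSpace K] [BorelSpace K]
    {H : Hypergroup K} {μ : Measure K} [μ.Regular] (hμ : H.IsLeftInvariant μ) (h0 : μ ≠ 0) :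
    μ.IsOpenPosMeasure := by
  refine ⟨fun U hU ⟨x₀, hx₀⟩ hU0 => ?_⟩
  obtain ⟨x₁, hx₁⟩ : μ.support.Nonempty := by
    have : NeZero μ := ⟨h0⟩
    exact nonempty_of_mem (Measure.support_mem_ae_of_regular (μ := μ))
  -- `x₀ ∈ supp (δ_a * δ_{x₁})`
  obtain ⟨a, ha⟩ := H.supp_nonempty x₀ (H.inv x₁)
  rw [H.mem_supp_inv_right_iff] at ha
  obtain ⟨f, hf1, hfU, hfc, hf01⟩ := exists_continuous_one_zero_of_isCompact
    (isCompact_singleton (x := x₀)) hU.isClosed_compl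
    (Set.disjoint_singleton_left.2 fun h => h hx₀)
  have hev : Continuous fun y => H.ev f a y :=
    (H.continuous_ev f.continuous hfc).comp (by fun_prop : Continuous fun y => (a, y))
  have hf0 : ∫ y, f y ∂μ = 0 := by
    refine integral_eq_zero_of_ae ?_
    have : Uᶜ ∈ ae μ := by simpa [mem_ae_iff] using hU0
    filter_upwards [this] with x hx using hfU hx
  rw [← hμ a f f.continuous hfc] at hf0
  have hevc : HasCompactSupport fun y => H.ev f a y := by
    refine HasCompactSupport.intro
      (H.isCompact_iUnion_supp ((isCompact_singleton (x := H.inv a)).prod hfc)) fun y hy => ?_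
    by_contra h
    obtain ⟨z, hz, hzs⟩ := H.exists_mem_supp_of_ev_ne_zero h
    refine hy (Set.mem_iUnion₂.2 ⟨(H.inv a, z), ⟨rfl, hz⟩, ?_⟩)
    rwa [← H.mem_supp_inv_left_iff, H.inv_inv]
  have hnn : ∀ y, 0 ≤ H.ev f a y := fun y => integral_nonneg fun t => (hf01 t).1
  have hpos : 0 < H.ev f a x₁ := H.integral_pos_of_supp f.continuous (fun t => (hf01 t).2)
    (fun t => (hf01 t).1) ha (by rw [hf1 rfl]; exact one_pos)
  refine hf0.not_gt ((integral_pos_iff_support_of_nonneg hnn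
    (hev.integrable_of_hasCompactSupport hevc)).2 ?_)
  exact (Measure.mem_support_iff_forall x₁).1 hx₁ _ (hev.isOpen_support.mem_nhds hpos.ne')

end Hypergroup

/-! ### Orlicz norms over arbitrary measures -/

theorem IsYoungFunction.le_mul {Φ : ℝ → ℝ} (h : IsYoungFunction Φ) {a x : ℝ} (ha : 0 ≤ a)
    (ha1 : a ≤ 1) : Φ (a * x) ≤ a * Φ x := by
  have hc := h.convex.2 (Set.mem_univ x) (Set.mem_univ 0) ha (sub_nonneg.2 ha1) (by ring)
  simpa [h.zero] using hc

/-- The slope `Φ(s)/s` nearly attains equality in Young's inequality: with `v = Φ(s)/s` one has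
`s v = Φ(s)` and `Ψ(v) ≤ Φ(s)`. -/
theorem YoungPair.Ψ_div_le (P : YoungPair) {s : ℝ} (hs : 0 ≤ s) : P.Ψ (P.Φ s / s) ≤ P.Φ s := by
  rcases hs.eq_or_lt with rfl | hs
  · simp [P.young_Φ.zero, P.young_Ψ.zero]
  refine (P.complementary _).2 ?_
  rintro _ ⟨y, hy, rfl⟩
  rw [abs_of_nonneg (div_nonneg (P.young_Φ.nonneg s) hs.le)]
  have h0 := P.young_Φ.nonneg s
  rcases le_total y s with hys | hys
  · have h1 : y * (P.Φ s / s) ≤ s * (P.Φ s / s) := by gcongr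
    rw [mul_div_cancel₀ _ hs.ne'] at h1
    linarith [P.young_Φ.nonneg y]
  · have hy0 : 0 < y := hs.trans_le hys
    have h1 := P.young_Φ.le_mul (a := s / y) (x := y) (by positivity) ((div_le_one hy0).2 hys)
    rw [div_mul_cancel₀ _ hy0.ne'] at h1
    have h2 : y * (P.Φ s / s) ≤ P.Φ y := by
      rw [← mul_div_assoc, div_le_iff₀ hs]
      rw [div_mul_eq_mul_div, le_div_iff₀ hy0] at h1
      linarith
    linarith

section Orlicz

variable {K : Type*} [MeasurableSpace K] {P : YoungPair} {μ : Measure K}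

theorem lintegral_le_of_ae_tendsto {F : ℕ → K → ℝ≥0∞} {f : K → ℝ≥0∞} {C : ℝ≥0∞}
    (hF : ∀ n, AEMeasurable (F n) μ) (hlim : ∀ᵐ x ∂μ, Tendsto (fun n => F n x) atTop (𝓝 (f x)))
    (hC : ∀ᶠ n in atTop, ∫⁻ x, F n x ∂μ ≤ C) : ∫⁻ x, f x ∂μ ≤ C :=
  calc ∫⁻ x, f x ∂μ = ∫⁻ x, liminf (fun n => F n x) atTop ∂μ :=
        lintegral_congr_ae (hlim.mono fun _ hx => hx.liminf_eq.symm)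
    _ ≤ liminf (fun n => ∫⁻ x, F n x ∂μ) atTop := lintegral_liminf_le' hF
    _ ≤ C := liminf_le_of_le (by isBoundedDefault) fun b hb =>
        (hb.and hC).exists.elim fun _ hn => hn.1.trans hn.2

theorem le_orliczNorm {f v : K → ℂ} (hv : Measurable v)
    (hv1 : ∫⁻ x, ENNReal.ofReal (P.Ψ ‖v x‖) ∂μ ≤ 1) :
    ∫⁻ x, ‖f x * v x‖ₑ ∂μ ≤ orliczNorm P μ f :=
  le_iSup_of_le v (le_iSup_of_le hv (le_iSup_of_le hv1 le_rfl))

theorem orliczNorm_le_mul {f g : K → ℂ} {b : ℝ≥0∞} (hb : b ≠ ∞)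
    (h : ∀ᵐ x ∂μ, ‖f x‖ₑ ≤ b * ‖g x‖ₑ) : orliczNorm P μ f ≤ b * orliczNorm P μ g := by
  refine iSup_le fun v => iSup_le fun hv => iSup_le fun hv1 => ?_
  calc ∫⁻ x, ‖f x * v x‖ₑ ∂μ ≤ ∫⁻ x, b * ‖g x * v x‖ₑ ∂μ := by
        refine lintegral_mono_ae ?_
        filter_upwards [h] with x hx
        rw [enorm_mul, enorm_mul, ← mul_assoc]
        gcongr
    _ = b * ∫⁻ x, ‖g x * v x‖ₑ ∂μ := lintegral_const_mul' _ _ hb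
    _ ≤ _ := by gcongr; exact le_orliczNorm hv hv1

theorem orliczNorm_mono {f g : K → ℂ} (h : ∀ᵐ x ∂μ, ‖f x‖ ≤ ‖g x‖) :
    orliczNorm P μ f ≤ orliczNorm P μ g := by
  rw [← one_mul (orliczNorm P μ g)]
  refine orliczNorm_le_mul ENNReal.one_ne_top (h.mono fun x hx => ?_)
  rw [one_mul]
  exact enorm_le_iff_norm_le.2 hx

theorem orliczNorm_sum_le {ι : Type*} (s : Finset ι) (c : ι → ℂ) {f : ι → K → ℂ}
    (hf : ∀ i, AEStronglyMeasurable (f i) μ) :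
    orliczNorm P μ (fun x => ∑ i ∈ s, c i * f i x) ≤ ∑ i ∈ s, ‖c i‖ₑ * orliczNorm P μ (f i) := by
  classical
  induction s using Finset.induction_on with
  | empty => simp [orliczNorm]
  | insert a s ha ih =>
    simp only [Finset.sum_insert ha]
    refine (orliczNorm_add_le ((hf a).const_mul (c a))).trans ?_
    rw [orliczNorm_const_mul]
    gcongr

/-- The Fatou property of the Orlicz norm. -/
theorem orliczNorm_le_of_ae_tendsto {F : ℕ → K → ℂ} {f : K → ℂ} {C : ℝ≥0∞}
    (hF : ∀ n, AEStronglyMeasurable (F n) μ)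
    (hlim : ∀ᵐ x ∂μ, Tendsto (fun n => F n x) atTop (𝓝 (f x)))
    (hC : ∀ᶠ n in atTop, orliczNorm P μ (F n) ≤ C) : orliczNorm P μ f ≤ C := by
  refine iSup_le fun v => iSup_le fun hv => iSup_le fun hv1 =>
    lintegral_le_of_ae_tendsto (F := fun n x => ‖F n x * v x‖ₑ)
      (fun n => ((hF n).mul hv.aestronglyMeasurable).enorm) ?_
      (hC.mono fun n hn => (le_orliczNorm hv hv1).trans hn)
  filter_upwards [hlim] with x hx
  exact (hx.mul_const _).enorm

theorem orliczFinite_of_bounded {f : K → ℂ} {S : Set K} (hS : MeasurableSet S) (hμS : μ S < ∞)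
    (hf0 : ∀ x ∉ S, f x = 0) {M : ℝ} (hM : ∀ x, ‖f x‖ ≤ M) : OrliczFinite P μ f := by
  refine ⟨1, one_pos, ?_⟩
  calc ∫⁻ x, ENNReal.ofReal (P.Φ (1 * ‖f x‖)) ∂μ
      ≤ ∫⁻ x, S.indicator (fun _ => ENNReal.ofReal (P.Φ M)) x ∂μ := by
        refine lintegral_mono fun x => ?_
        rw [one_mul]
        by_cases hx : x ∈ S
        · rw [Set.indicator_of_mem hx]
          exact ENNReal.ofReal_le_ofReal (P.young_Φ.mono (norm_nonneg _) (hM x))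
        · simp [hf0 x hx, P.young_Φ.zero]
    _ = ENNReal.ofReal (P.Φ M) * μ S := lintegral_indicator_const hS _
    _ < ∞ := ENNReal.mul_lt_top ENNReal.ofReal_lt_top hμS

/-- On sets of finite measure the Orlicz norm dominates the `L¹` norm. -/
theorem exists_setLIntegral_le_orliczNorm (P : YoungPair) {S : Set K} (hS : MeasurableSet S)
    (hμS : μ S < ∞) :
    ∃ c : ℝ≥0∞, c ≠ ∞ ∧ ∀ f : K → ℂ, ∫⁻ x in S, ‖f x‖ₑ ∂μ ≤ c * orliczNorm P μ f := by
  set m := (μ S).toReal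
  have hm : 0 ≤ m := ENNReal.toReal_nonneg
  have hΨ := P.young_Ψ.nonneg 1
  -- `v = a 1_S` is admissible for this value of `a`
  set a : ℝ := (1 + P.Ψ 1 * m)⁻¹
  have ha : 0 < a := by positivity
  have ha1 : a ≤ 1 := inv_le_one_of_one_le₀ (by nlinarith [mul_nonneg hΨ hm])
  have hΨa : P.Ψ a * m ≤ 1 := by
    have h1 := P.young_Ψ.le_mul (x := 1) ha.le ha1
    rw [mul_one] at h1
    calc P.Ψ a * m ≤ a * P.Ψ 1 * m := by gcongr
      _ = (P.Ψ 1 * m) / (1 + P.Ψ 1 * m) := by rw [div_eq_inv_mul, mul_assoc]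
      _ ≤ 1 := (div_le_one (by positivity)).2 (by linarith)
  refine ⟨ENNReal.ofReal a⁻¹, ENNReal.ofReal_ne_top, fun f => ?_⟩
  have hv : Measurable (S.indicator fun _ => (a : ℂ)) := measurable_const.indicator hS
  have hv1 : ∫⁻ x, ENNReal.ofReal (P.Ψ ‖S.indicator (fun _ => (a : ℂ)) x‖) ∂μ ≤ 1 := by
    have h1 : (fun x => ENNReal.ofReal (P.Ψ ‖S.indicator (fun _ => (a : ℂ)) x‖)) =
        S.indicator fun _ => ENNReal.ofReal (P.Ψ a) := by
      ext x
      by_cases hx : x ∈ S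
      · simp [hx, abs_of_pos ha]
      · simp [hx, P.young_Ψ.zero]
    rw [h1, lintegral_indicator_const hS, ← ENNReal.ofReal_toReal hμS.ne,
      ← ENNReal.ofReal_mul (P.young_Ψ.nonneg _), ← ENNReal.ofReal_one]
    exact ENNReal.ofReal_le_ofReal hΨa
  have h2 := le_orliczNorm (f := f) hv hv1
  have h3 : ∫⁻ x, ‖f x * S.indicator (fun _ => (a : ℂ)) x‖ₑ ∂μ =
      (∫⁻ x in S, ‖f x‖ₑ ∂μ) * ENNReal.ofReal a := by
    rw [← lintegral_mul_const' _ _ ENNReal.ofReal_ne_top, ← lintegral_indicator hS]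
    refine lintegral_congr fun x => ?_
    by_cases hx : x ∈ S
    · rw [Set.indicator_of_mem hx, Set.indicator_of_mem hx, enorm_mul, ← ofReal_norm (a : ℂ),
        Complex.norm_real, Real.norm_of_nonneg ha.le]
    · simp [hx]
  rw [h3] at h2
  calc ∫⁻ x in S, ‖f x‖ₑ ∂μ
      = ENNReal.ofReal a⁻¹ * ((∫⁻ x in S, ‖f x‖ₑ ∂μ) * ENNReal.ofReal a) := by
        rw [mul_comm, mul_assoc, ← ENNReal.ofReal_mul ha.le, mul_inv_cancel₀ ha.ne',
          ENNReal.ofReal_one, mul_one]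
    _ ≤ _ := by gcongr

/-- An Orlicz norm below one forces the modular `∫ Φ(|f|)` to be at most one. The hypotheses on `f`
make the modular finite, so that it can serve to normalize a test function. -/
theorem lintegral_Φ_le_one_of_bounded {f : K → ℂ} (hf : Measurable f) {S : Set K}
    (hS : MeasurableSet S) (hμS : μ S < ∞) (hf0 : ∀ x ∉ S, f x = 0) {M : ℝ} (hM : ∀ x, ‖f x‖ ≤ M)
    (h1 : orliczNorm P μ f < 1) : ∫⁻ x, ENNReal.ofReal (P.Φ ‖f x‖) ∂μ ≤ 1 := by
  set I := ∫⁻ x, ENNReal.ofReal (P.Φ ‖f x‖) ∂μ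
  have hI : I ≠ ∞ := by
    refine ne_top_of_le_ne_top (b := ENNReal.ofReal (P.Φ M) * μ S)
      (ENNReal.mul_lt_top ENNReal.ofReal_lt_top hμS).ne ?_
    rw [← lintegral_indicator_const hS]
    refine lintegral_mono fun x => ?_
    by_cases hx : x ∈ S
    · rw [Set.indicator_of_mem hx]
      exact ENNReal.ofReal_le_ofReal (P.young_Φ.mono (norm_nonneg _) (hM x))
    · simp [hf0 x hx, P.young_Φ.zero]
  by_contra! hI1
  -- the test function `v = Φ(|f|) / (|f| I)` gives `∫ |f v| = 1`
  set r := I.toReal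
  have hr : 1 < r := by rwa [← ENNReal.toReal_one, ENNReal.toReal_lt_toReal ENNReal.one_ne_top hI]
  have hr0 : 0 < r := one_pos.trans hr
  have hIr : I * ENNReal.ofReal r⁻¹ = 1 := by
    rw [← ENNReal.ofReal_toReal hI, ← ENNReal.ofReal_mul hr0.le, mul_inv_cancel₀ hr0.ne',
      ENNReal.ofReal_one]
  let v : K → ℂ := fun x => ((r⁻¹ * (P.Φ ‖f x‖ / ‖f x‖) : ℝ) : ℂ)
  have hvn : ∀ x, ‖v x‖ = r⁻¹ * (P.Φ ‖f x‖ / ‖f x‖) := fun x => by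
    rw [Complex.norm_real, Real.norm_of_nonneg]
    have := P.young_Φ.nonneg ‖f x‖
    positivity
  have hv : Measurable v := Complex.measurable_ofReal.comp
    (((P.young_Φ.measurable.comp hf.norm).div hf.norm).const_mul _)
  have hv1 : ∫⁻ x, ENNReal.ofReal (P.Ψ ‖v x‖) ∂μ ≤ 1 := by
    rw [← hIr, ← lintegral_mul_const' _ _ ENNReal.ofReal_ne_top]
    refine lintegral_mono fun x => ?_
    rw [← ENNReal.ofReal_mul (P.young_Φ.nonneg _), hvn]
    refine ENNReal.ofReal_le_ofReal ((P.young_Ψ.le_mul (by positivity)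
      (inv_le_one_of_one_le₀ hr.le)).trans ?_)
    rw [mul_comm]
    gcongr
    exact P.Ψ_div_le (norm_nonneg _)
  refine (h1.trans_le ?_).false
  calc (1 : ℝ≥0∞) = ∫⁻ x, ‖f x * v x‖ₑ ∂μ := by
        rw [← hIr, ← lintegral_mul_const' _ _ ENNReal.ofReal_ne_top]
        refine lintegral_congr fun x => ?_
        rw [← ENNReal.ofReal_mul (P.young_Φ.nonneg _), ← ofReal_norm, norm_mul, hvn]
        congr 1
        rcases eq_or_ne ‖f x‖ 0 with h | h
        · rw [h, P.young_Φ.zero]; simp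
        · field_simp
    _ ≤ _ := le_orliczNorm hv hv1

/-- `f` vanishes almost everywhere off a countable union of sets of finite measure. -/
def SigmaFinitelySupported (μ : Measure K) (f : K → ℂ) : Prop :=
  ∃ S : ℕ → Set K, (∀ n, MeasurableSet (S n)) ∧ (∀ n, μ (S n) < ∞) ∧
    ∀ᵐ x ∂μ, x ∉ ⋃ n, S n → f x = 0

/-- Countably many σ-finitely supported functions have a common σ-finite support. -/
theorem exists_common_sigmaFinite_support {f : ℕ → K → ℂ}
    (hf : ∀ i, SigmaFinitelySupported μ (f i)) :
    ∃ S : ℕ → Set K, (∀ n, MeasurableSet (S n)) ∧ (∀ n, μ (S n) < ∞) ∧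
      ∀ᵐ x ∂μ, x ∉ ⋃ n, S n → ∀ i, f i x = 0 := by
  choose S hS hμS hS0 using hf
  refine ⟨fun n => S n.unpair.1 n.unpair.2, fun n => hS _ _, fun n => hμS _ _, ?_⟩
  filter_upwards [ae_all_iff.2 hS0] with x hx hxS i
  refine hx i fun h => hxS ?_
  obtain ⟨j, hj⟩ := Set.mem_iUnion.1 h
  exact Set.mem_iUnion.2 ⟨Nat.pair i j, by simpa using hj⟩

namespace SigmaFinitelySupported

theorem of_ae_imp {f g h : K → ℂ} (hf : SigmaFinitelySupported μ f)
    (hg : SigmaFinitelySupported μ g) (hfg : ∀ᵐ x ∂μ, f x = 0 → g x = 0 → h x = 0) :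
    SigmaFinitelySupported μ h := by
  obtain ⟨S, hS, hμS, hS0⟩ := exists_common_sigmaFinite_support (μ := μ)
    (f := fun n => if n = 0 then f else g) (fun i => by split_ifs <;> assumption)
  refine ⟨S, hS, hμS, ?_⟩
  filter_upwards [hS0, hfg] with x hx hx1 hxS
  exact hx1 (by simpa using hx hxS 0) (by simpa using hx hxS 1)

theorem congr_ae {f g : K → ℂ} (hf : SigmaFinitelySupported μ f) (h : f =ᵐ[μ] g) :
    SigmaFinitelySupported μ g :=
  hf.of_ae_imp hf (h.mono fun x hx h0 _ => by rw [← hx, h0])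

theorem zero : SigmaFinitelySupported μ (0 : K → ℂ) :=
  ⟨fun _ => ∅, fun _ => MeasurableSet.empty, fun _ => by simp, by simp⟩

end SigmaFinitelySupported

/-- A function of finite Orlicz norm whose support is σ-finite belongs to the Orlicz space. -/
theorem orliczFinite_of_orliczNorm_lt_top {f : K → ℂ} (hf : AEStronglyMeasurable f μ)
    (hfs : SigmaFinitelySupported μ f) (hfin : orliczNorm P μ f < ∞) : OrliczFinite P μ f := by
  obtain ⟨S, hS, hμS, hf0⟩ := hfs
  let f₁ := hf.mk f
  have hf₁ : Measurable f₁ := hf.stronglyMeasurable_mk.measurable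
  have hff₁ : f =ᵐ[μ] f₁ := hf.ae_eq_mk
  rw [orliczNorm_congr_ae hff₁] at hfin
  refine OrliczFinite.congr_ae hff₁.symm ?_
  set N := (orliczNorm P μ f₁).toReal
  have hN : 0 ≤ N := ENNReal.toReal_nonneg
  set α : ℝ := (N + 1)⁻¹
  have hα : 0 < α := by positivity
  refine ⟨α, hα, lt_of_le_of_lt ?_ ENNReal.one_lt_top⟩
  let A : ℕ → Set K := fun n => Set.accumulate S n ∩ {x | ‖f₁ x‖ ≤ n}
  have hA : ∀ n, MeasurableSet (A n) := fun n =>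
    (MeasurableSet.biUnion (Set.to_countable _) fun i _ => hS i).inter
      (measurableSet_le hf₁.norm measurable_const)
  have hμA : ∀ n, μ (A n) < ∞ := fun n => (measure_mono Set.inter_subset_left).trans_lt
    (measure_biUnion_lt_top (Set.finite_Iic n) fun i _ => hμS i)
  refine lintegral_le_of_ae_tendsto
    (F := fun n x => ENNReal.ofReal (P.Φ ‖(A n).indicator (fun x => (α : ℂ) * f₁ x) x‖))
    (fun n => ((P.young_Φ.measurable.comp
      ((hf₁.const_mul _).indicator (hA n)).norm).ennreal_ofReal).aemeasurable) ?_
    (Eventually.of_forall fun n => ?_)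
  · filter_upwards [hf0, hff₁] with x hx0 hx1
    refine tendsto_const_nhds.congr' ?_
    have hα' : ‖(α : ℂ) * f₁ x‖ = α * ‖f₁ x‖ := by
      rw [norm_mul, Complex.norm_real, Real.norm_of_nonneg hα.le]
    by_cases hx : x ∈ ⋃ n, S n
    · obtain ⟨i, hi⟩ := Set.mem_iUnion.1 hx
      filter_upwards [eventually_ge_atTop i, eventually_ge_atTop ⌈‖f₁ x‖⌉₊] with n hn1 hn2
      rw [Set.indicator_of_mem, hα']
      exact ⟨Set.mem_biUnion (show i ∈ {y | y ≤ n} from hn1) hi, Nat.ceil_le.1 hn2⟩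
    · have hx2 : f₁ x = 0 := by rw [← hx1, hx0 hx]
      exact Eventually.of_forall fun n => by
        have hxA : (A n).indicator (fun x => (α : ℂ) * f₁ x) x = 0 := by
          rw [Set.indicator_apply_eq_zero]
          intro _
          rw [hx2, mul_zero]
        simp only [hxA, hx2, norm_zero, mul_zero]
  · refine lintegral_Φ_le_one_of_bounded ((hf₁.const_mul _).indicator (hA n)) (hA n) (hμA n)
      (fun x hx => Set.indicator_of_notMem hx _) (M := α * n) (fun x => ?_) ?_
    · by_cases hx : x ∈ A n
      · rw [Set.indicator_of_mem hx, norm_mul, Complex.norm_real, Real.norm_of_nonneg hα.le]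
        exact mul_le_mul_of_nonneg_left hx.2 hα.le
      · rw [Set.indicator_of_notMem hx, norm_zero]; positivity
    · have hmono : ∀ x, ‖(A n).indicator (fun x => (α : ℂ) * f₁ x) x‖ ≤ ‖(α : ℂ) * f₁ x‖ :=
        fun x => norm_indicator_le_norm_self _ _
      refine (orliczNorm_mono (ae_of_all _ hmono)).trans_lt ?_
      rw [orliczNorm_const_mul, ← ofReal_norm, Complex.norm_real, Real.norm_of_nonneg hα.le,
        ← ENNReal.ofReal_toReal hfin.ne, ← ENNReal.ofReal_mul hα.le, ← ENNReal.ofReal_one]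
      refine (ENNReal.ofReal_lt_ofReal_iff one_pos).2 ?_
      change (N + 1)⁻¹ * N < 1
      rw [inv_mul_lt_iff₀ (by positivity)]
      linarith

end Orlicz

/-! ### Integral operators with properly supported continuous kernels -/

/-- A continuous kernel `k` on `K × K` whose support is proper over both factors: for one variable
in a compact set, `k` is supported in a compact set of the other variable. -/
structure IsProperKernel {K : Type*} [TopologicalSpace K] (k : K → K → ℂ) : Prop where
  continuous : Continuous fun p : K × K => k p.1 p.2
  exists_right : ∀ C, IsCompact C → ∃ D, IsCompact D ∧ ∀ y ∈ C, ∀ x ∉ D, k y x = 0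
  exists_left : ∀ D, IsCompact D → ∃ C, IsCompact C ∧ ∀ x ∈ D, ∀ y ∉ C, k y x = 0

theorem exists_measurable_partition {K : Type*} [MeasurableSpace K] {n : ℕ} {U : Fin n → Set K}
    (hU : ∀ i, MeasurableSet (U i)) {A : Set K} (hA : MeasurableSet A) (hAU : A ⊆ ⋃ i, U i) :
    ∃ S : Fin n → Set K, (∀ i, MeasurableSet (S i)) ∧ (∀ i, S i ⊆ U i) ∧
      Pairwise (Function.onFun Disjoint S) ∧ ⋃ i, S i = A := by
  refine ⟨fun i => A ∩ (U i \ ⋃ j < i, U j), fun i => hA.inter ((hU i).diff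
    (MeasurableSet.biUnion (Set.to_countable _) fun j _ => hU j)),
    fun i x hx => hx.2.1, ?_, ?_⟩
  · have key : ∀ i j, i < j →
        Disjoint (A ∩ (U i \ ⋃ l < i, U l)) (A ∩ (U j \ ⋃ l < j, U l)) := fun i j hij =>
      Set.disjoint_left.2 fun x hx hy => hy.2.2 <|
        Set.mem_biUnion (show i ∈ {l | l < j} from hij) hx.2.1
    intro i j hij
    rcases lt_or_gt_of_ne hij with h | h
    · exact key i j h
    · exact (key j i h).symm
  · refine Set.Subset.antisymm (Set.iUnion_subset fun i => Set.inter_subset_left) fun x hx => ?_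
    have hne : ∃ i, x ∈ U i := Set.mem_iUnion.1 (hAU hx)
    obtain ⟨i, hi, hmin⟩ := WellFounded.has_min (wellFounded_lt (α := Fin n)) {i | x ∈ U i} hne
    refine Set.mem_iUnion.2 ⟨i, hx, hi, fun h => ?_⟩
    obtain ⟨j, hj, hxj⟩ := Set.mem_iUnion₂.1 h
    exact hmin j hxj hj

/-- An integrable function vanishes almost everywhere off a σ-compact set. -/
theorem exists_isCompact_monotone_ae_eq_zero {K : Type*} [TopologicalSpace K] [T2Space K]
    [MeasurableSpace K] [BorelSpace K] {μ : Measure K} [μ.Regular] {F : K → ℂ}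
    (hF : Integrable F μ) :
    ∃ C : ℕ → Set K, (∀ n, IsCompact (C n)) ∧ Monotone C ∧ ∀ᵐ y ∂μ, y ∉ ⋃ n, C n → F y = 0 := by
  let F₁ := hF.1.mk F
  have hF₁ : Measurable F₁ := hF.1.stronglyMeasurable_mk.measurable
  have hFF₁ : F =ᵐ[μ] F₁ := hF.1.ae_eq_mk
  let B : ℕ → Set K := fun n => {y | 1 / ((n : ℝ) + 1) ≤ ‖F₁ y‖}
  have hB : ∀ n, MeasurableSet (B n) := fun n => measurableSet_le measurable_const hF₁.norm
  have hμB : ∀ n, μ (B n) ≠ ∞ := fun n =>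
    ((hF.congr hFF₁).measure_norm_ge_lt_top (by positivity)).ne
  have h1 : ∀ n m : ℕ, ∃ C ⊆ B n, IsCompact C ∧ μ (B n \ C) < ((m : ℝ≥0∞) + 1)⁻¹ := fun n m =>
    (hB n).exists_isCompact_sdiff_lt (hμB n) (by simp)
  choose C hCB hC hμC using h1
  have h2 : ∀ n, μ (B n \ ⋃ m, C n m) = 0 := fun n => by
    refine le_antisymm (ge_of_tendsto' (x := atTop) (f := fun m : ℕ => ((m : ℝ≥0∞) + 1)⁻¹) ?_
      fun m => ?_) zero_le
    · have := (tendsto_add_atTop_iff_nat 1).2 ENNReal.tendsto_inv_nat_nhds_zero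
      simpa using this
    · exact (measure_mono (Set.sdiff_subset_sdiff_right (Set.subset_iUnion _ m))).trans (hμC n m).le
  refine ⟨Set.accumulate fun i => C i.unpair.1 i.unpair.2,
    fun n => isCompact_accumulate (fun i => hC _ _) n, Set.monotone_accumulate, ?_⟩
  have h3 : ∀ᵐ y ∂μ, ∀ n, y ∉ B n \ ⋃ m, C n m := ae_all_iff.2 fun n =>
    measure_eq_zero_iff_ae_notMem.1 (h2 n)
  filter_upwards [h3, hFF₁] with y hy hy1 hyC
  by_contra hy2
  obtain ⟨n, hn⟩ := exists_nat_one_div_lt (norm_pos_iff.2 (hy1 ▸ hy2 : F₁ y ≠ 0))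
  refine hy n ⟨hn.le, fun h => hyC ?_⟩
  obtain ⟨m, hm⟩ := Set.mem_iUnion.1 h
  rw [Set.iUnion_accumulate]
  exact Set.mem_iUnion.2 ⟨Nat.pair n m, by simpa using hm⟩

/-- Functions vanishing off a fixed compact set have small Orlicz norm when they are uniformly
small. -/
theorem exists_orliczNorm_le_mul_of_isCompact {K : Type*} [TopologicalSpace K] [T2Space K]
    [MeasurableSpace K] [BorelSpace K] (P : YoungPair) {μ : Measure K}
    [IsFiniteMeasureOnCompacts μ] {D : Set K} (hD : IsCompact D) {ε : ℝ≥0∞} (hε : ε ≠ 0) :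
    ∃ δ : ℝ, 0 < δ ∧ ∀ (I : ℝ≥0∞) (f : K → ℂ), I ≠ ∞ → (∀ x ∉ D, f x = 0) →
      (∀ x, ‖f x‖ₑ ≤ ENNReal.ofReal δ * I) → orliczNorm P μ f ≤ ε * I := by
  have h1 : OrliczFinite P μ (D.indicator fun _ => (1 : ℂ)) :=
    orliczFinite_of_bounded hD.measurableSet hD.measure_lt_top
      (fun x hx => Set.indicator_of_notMem hx _) (M := 1) fun x => by
        refine (norm_indicator_le_norm_self _ _).trans ?_
        simp
  have h2 := orliczNorm_lt_top h1
  set N := orliczNorm P μ (D.indicator fun _ => (1 : ℂ))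
  obtain ⟨δ, hδ0, hδ⟩ := ENNReal.exists_nnreal_pos_mul_lt h2.ne hε
  refine ⟨δ, by exact_mod_cast hδ0, fun I f hI hf0 hf => ?_⟩
  rw [ENNReal.ofReal_coe_nnreal] at hf
  calc orliczNorm P μ f ≤ (δ * I) * N := by
        refine orliczNorm_le_mul (ENNReal.mul_ne_top ENNReal.coe_ne_top hI)
          (ae_of_all _ fun x => ?_)
        by_cases hx : x ∈ D
        · rw [Set.indicator_of_mem hx, enorm_one, mul_one]; exact hf x
        · rw [hf0 x hx, enorm_zero]; exact zero_le
    _ = (δ * N) * I := by ring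
    _ ≤ ε * I := by gcongr

namespace IsProperKernel

variable {K : Type*} [TopologicalSpace K] {k : K → K → ℂ}

theorem flip (hk : IsProperKernel k) : IsProperKernel fun x y => k y x :=
  ⟨hk.continuous.comp continuous_swap, hk.exists_left, hk.exists_right⟩

theorem continuous_right (hk : IsProperKernel k) (y : K) : Continuous (k y) :=
  hk.continuous.comp (by fun_prop : Continuous fun x => (y, x))

theorem hasCompactSupport (hk : IsProperKernel k) [T2Space K] (y : K) :
    HasCompactSupport (k y) := by
  obtain ⟨D, hD, h⟩ := hk.exists_right {y} isCompact_singleton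
  exact HasCompactSupport.intro hD fun x hx => h y rfl x hx

/-- `y ↦ k(y, ·)` is continuous for the supremum norm. -/
theorem eventually_norm_sub_le [WeaklyLocallyCompactSpace K] (hk : IsProperKernel k) (y : K)
    {δ : ℝ} (hδ : 0 < δ) : ∀ᶠ y' in 𝓝 y, ∀ x, ‖k y' x - k y x‖ ≤ δ := by
  obtain ⟨C, hC, hCy⟩ := exists_compact_mem_nhds y
  obtain ⟨D, hD, hCD⟩ := hk.exists_right C hC
  have h1 := (ContinuousMap.curry ⟨_, hk.continuous⟩).continuous.tendsto y
  rw [ContinuousMap.tendsto_iff_forall_isCompact_tendstoUniformlyOn] at h1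
  have h2 := Metric.tendstoUniformlyOn_iff.1 (h1 D hD) δ hδ
  filter_upwards [h2, hCy] with y' hy' hy'C x
  by_cases hx : x ∈ D
  · have := hy' x hx
    rw [dist_comm, dist_eq_norm] at this
    exact this.le
  · rw [hCD y' hy'C x hx, hCD y (mem_of_mem_nhds hCy) x hx, sub_zero, norm_zero]
    exact hδ.le

theorem exists_partition [WeaklyLocallyCompactSpace K] [MeasurableSpace K]
    [OpensMeasurableSpace K] (hk : IsProperKernel k) {C A : Set K} (hC : IsCompact C)
    (hA : MeasurableSet A) (hAC : A ⊆ C) {δ : ℝ} (hδ : 0 < δ) :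
    ∃ (n : ℕ) (y : Fin n → K) (S : Fin n → Set K), (∀ i, MeasurableSet (S i)) ∧
      Pairwise (Function.onFun Disjoint S) ∧ ⋃ i, S i = A ∧ (∀ i, (S i).Nonempty → y i ∈ S i) ∧
      ∀ i, ∀ y' ∈ S i, ∀ x, ‖k y' x - k (y i) x‖ ≤ δ := by
  have h1 : ∀ y, ∃ U : Set K, IsOpen U ∧ y ∈ U ∧ ∀ y' ∈ U, ∀ x, ‖k y' x - k y x‖ ≤ δ / 2 :=
    fun y => by
      obtain ⟨U, hU, hUo, hyU⟩ := eventually_nhds_iff.1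
        (hk.eventually_norm_sub_le y (half_pos hδ))
      exact ⟨U, hUo, hyU, hU⟩
  choose U hUo hyU hU using h1
  obtain ⟨t, -, ht⟩ := hC.elim_nhds_subcover U fun y _ => (hUo y).mem_nhds (hyU y)
  let e := t.equivFin
  obtain ⟨S, hS, hSU, hSd, hSA⟩ := exists_measurable_partition
    (U := fun i => U (e.symm i)) (fun i => (hUo _).measurableSet) hA (fun x hx => by
      obtain ⟨y, hy, hxy⟩ := Set.mem_iUnion₂.1 (ht (hAC hx))
      exact Set.mem_iUnion.2 ⟨e ⟨y, hy⟩, by simpa using hxy⟩)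
  classical
  let y : Fin t.card → K := fun i => if h : (S i).Nonempty then h.choose else e.symm i
  have hy : ∀ i, (S i).Nonempty → y i ∈ S i := fun i h => by
    simp only [y, dif_pos h]
    exact h.choose_spec
  refine ⟨_, y, S, hS, hSd, hSA, hy, fun i y' hy' x => ?_⟩
  have h2 := hU _ _ (hSU i hy') x
  have h3 := hU _ _ (hSU i (hy i ⟨y', hy'⟩)) x
  calc ‖k y' x - k (y i) x‖ = ‖(k y' x - k (e.symm i) x) - (k (y i) x - k (e.symm i) x)‖ := by
        congr 1; ring
    _ ≤ δ / 2 + δ / 2 := (norm_sub_le _ _).trans (add_le_add h2 h3)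
    _ = δ := add_halves δ

variable [MeasurableSpace K] [BorelSpace K]

theorem integrable_mul [T2Space K] {μ : Measure K} (hk : IsProperKernel k) {F : K → ℂ}
    (hF : Integrable F μ) (x : K) : Integrable (fun y => F y * k y x) μ := by
  obtain ⟨M, hM⟩ := (hk.flip.hasCompactSupport x).exists_bound_of_continuous
    (hk.flip.continuous_right x)
  exact hF.mul_bdd (hk.flip.continuous_right x).measurable.aestronglyMeasurable (ae_of_all _ hM)

theorem continuous_integral [T2Space K] [WeaklyLocallyCompactSpace K] {μ : Measure K}
    (hk : IsProperKernel k) {F : K → ℂ} (hF : Integrable F μ) :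
    Continuous fun x => ∫ y, F y * k y x ∂μ := by
  rw [continuous_iff_continuousAt]
  intro x
  rw [ContinuousAt, Metric.tendsto_nhds]
  intro ε hε
  set I := ∫ y, ‖F y‖ ∂μ
  have hI : 0 ≤ I := integral_nonneg fun _ => norm_nonneg _
  filter_upwards [hk.flip.eventually_norm_sub_le x (δ := ε / (I + 1)) (by positivity)] with x' hx'
  rw [dist_eq_norm, ← integral_sub (hk.integrable_mul hF x') (hk.integrable_mul hF x)]
  calc ‖∫ y, (F y * k y x' - F y * k y x) ∂μ‖ ≤ ∫ y, ‖F y‖ * (ε / (I + 1)) ∂μ := by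
        refine norm_integral_le_of_norm_le (hF.norm.mul_const _) (ae_of_all _ fun y => ?_)
        rw [← mul_sub, norm_mul]
        exact mul_le_mul_of_nonneg_left (hx' y) (norm_nonneg _)
    _ = I * (ε / (I + 1)) := integral_mul_const _ _
    _ < ε := by
        rw [mul_div_assoc', div_lt_iff₀ (by positivity)]
        nlinarith

theorem sigmaFinitelySupported_integral [T2Space K] {μ : Measure K} [μ.Regular]
    (hk : IsProperKernel k) {F : K → ℂ} (hF : Integrable F μ) :
    SigmaFinitelySupported μ fun x => ∫ y, F y * k y x ∂μ := by
  obtain ⟨C, hC, -, hC0⟩ := exists_isCompact_monotone_ae_eq_zero hF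
  choose D hD hD0 using fun n => hk.exists_right (C n) (hC n)
  refine ⟨D, fun n => (hD n).measurableSet, fun n => (hD n).measure_lt_top, ae_of_all _ ?_⟩
  intro x hx
  refine integral_eq_zero_of_ae ?_
  filter_upwards [hC0] with y hy
  by_cases hyC : y ∈ ⋃ n, C n
  · obtain ⟨n, hn⟩ := Set.mem_iUnion.1 hyC
    rw [hD0 n y hn x fun h => hx (Set.mem_iUnion.2 ⟨n, h⟩), mul_zero, Pi.zero_apply]
  · rw [hy hyC, zero_mul, Pi.zero_apply]

theorem orliczFinite [T2Space K] {μ : Measure K} [IsFiniteMeasureOnCompacts μ]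
    (hk : IsProperKernel k) (P : YoungPair) (y : K) : OrliczFinite P μ (k y) := by
  obtain ⟨D, hD, h⟩ := hk.exists_right {y} isCompact_singleton
  obtain ⟨M, hM⟩ := (hk.hasCompactSupport y).exists_bound_of_continuous (hk.continuous_right y)
  exact orliczFinite_of_bounded hD.measurableSet hD.measure_lt_top (h y rfl) hM

theorem exists_orliczNorm_le_of_isCompact [T2Space K] (hk : IsProperKernel k) (P : YoungPair)
    {μ : Measure K} [IsFiniteMeasureOnCompacts μ] {C : Set K} (hC : IsCompact C) :
    ∃ M : ℝ≥0∞, M ≠ ∞ ∧ ∀ y ∈ C, orliczNorm P μ (k y) ≤ M := by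
  obtain ⟨D, hD, hCD⟩ := hk.exists_right C hC
  obtain ⟨b, hb⟩ := (hC.prod hD).exists_bound_of_continuousOn hk.continuous.continuousOn
  obtain ⟨δ, hδ, hδ1⟩ := exists_orliczNorm_le_mul_of_isCompact P (μ := μ) hD one_ne_zero
  refine ⟨1 * ENNReal.ofReal (b / δ), by simp, fun y hy => hδ1 _ _ ENNReal.ofReal_ne_top
    (hCD y hy) fun x => ?_⟩
  rw [← ENNReal.ofReal_mul hδ.le, mul_div_cancel₀ _ hδ.ne', ← ofReal_norm]
  by_cases hx : x ∈ D
  · exact ENNReal.ofReal_le_ofReal (hb (y, x) ⟨hy, hx⟩)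
  · simp [hCD y hy x hx]

/-- On a relatively compact set the integral operator is approximated in operator norm by operators
of finite rank with values in the span of the `k(y, ·)`. -/
theorem exists_finite_rank_approx [T2Space K] [WeaklyLocallyCompactSpace K] (P : YoungPair)
    {μ : Measure K} [IsFiniteMeasureOnCompacts μ]
    (hk : IsProperKernel k) {C A : Set K} (hC : IsCompact C)
    (hA : MeasurableSet A) (hAC : A ⊆ C) {ε : ℝ≥0∞} (hε : ε ≠ 0) :
    ∃ (n : ℕ) (y : Fin n → K) (S : Fin n → Set K), (∀ i, (S i).Nonempty → y i ∈ A) ∧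
      ∀ F : K → ℂ, IntegrableOn F A μ →
        ∑ i, ‖∫ z in S i, F z ∂μ‖ₑ ≤ ∫⁻ z in A, ‖F z‖ₑ ∂μ ∧
        orliczNorm P μ (fun x => ∫ z in A, F z * k z x ∂μ - ∑ i, (∫ z in S i, F z ∂μ) * k (y i) x) ≤
          ε * ∫⁻ z in A, ‖F z‖ₑ ∂μ := by
  obtain ⟨D, hD, hCD⟩ := hk.exists_right C hC
  obtain ⟨δ, hδ, hδε⟩ := exists_orliczNorm_le_mul_of_isCompact P (μ := μ) hD hε
  obtain ⟨n, y, S, hS, hSd, hSA, hy, hyS⟩ := hk.exists_partition hC hA hAC hδ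
  have hSiA : ∀ i, S i ⊆ A := fun i => hSA ▸ Set.subset_iUnion S i
  refine ⟨n, y, S, fun i h => hSiA i (hy i h), fun F hF => ?_⟩
  have hsum : ∫⁻ z in A, ‖F z‖ₑ ∂μ = ∑ i, ∫⁻ z in S i, ‖F z‖ₑ ∂μ := by
    rw [← hSA, lintegral_iUnion hS hSd, tsum_fintype]
  refine ⟨?_, hδε _ _ hF.2.ne ?_ ?_⟩
  · rw [hsum]
    exact Finset.sum_le_sum fun i _ => enorm_integral_le_lintegral_enorm _
  · intro x hx
    rw [setIntegral_eq_zero_of_forall_eq_zero fun z hz => by rw [hCD z (hAC hz) x hx, mul_zero],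
      Finset.sum_eq_zero, sub_zero]
    intro i _
    rcases (S i).eq_empty_or_nonempty with h | h
    · simp [h]
    · rw [hCD _ (hAC (hSiA i (hy i h))) x hx, mul_zero]
  · intro x
    have hint : ∀ i, IntegrableOn F (S i) μ := fun i => hF.mono_set (hSiA i)
    have h1 : ∫ z in A, F z * k z x ∂μ - ∑ i, (∫ z in S i, F z ∂μ) * k (y i) x =
        ∑ i, ∫ z in S i, F z * (k z x - k (y i) x) ∂μ := by
      rw [← hSA, integral_iUnion_fintype hS hSd fun i => hk.integrable_mul (hint i) x,
        ← Finset.sum_sub_distrib]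
      refine Finset.sum_congr rfl fun i _ => ?_
      rw [← integral_mul_const, ← integral_sub (hk.integrable_mul (hint i) x)
        ((hint i).mul_const _)]
      simp only [mul_sub]
    rw [h1, hsum, Finset.mul_sum]
    refine (enorm_sum_le _ _).trans (Finset.sum_le_sum fun i _ => ?_)
    refine (enorm_integral_le_lintegral_enorm _).trans ?_
    rw [← lintegral_const_mul' _ _ ENNReal.ofReal_ne_top]
    refine setLIntegral_mono' (hS i) fun z hz => ?_
    rw [enorm_mul, mul_comm]
    gcongr
    rw [← ofReal_norm]
    exact ENNReal.ofReal_le_ofReal (hyS i z hz x)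

/-- Minkowski's integral inequality for the Orlicz norm. It is obtained from Riemann sums rather
than from Fubini's theorem, as `μ` need not be σ-finite. -/
theorem orliczNorm_integral_le [T2Space K] [WeaklyLocallyCompactSpace K] {P : YoungPair}
    {μ : Measure K} [μ.Regular] (hk : IsProperKernel k) {A : Set K} (hA : MeasurableSet A)
    {M : ℝ≥0∞} (hM : ∀ y ∈ A, orliczNorm P μ (k y) ≤ M) {F : K → ℂ} (hF : Integrable F μ) :
    orliczNorm P μ (fun x => ∫ y in A, F y * k y x ∂μ) ≤ M * ∫⁻ y in A, ‖F y‖ₑ ∂μ := by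
  have hkm : ∀ y, AEStronglyMeasurable (k y) μ := fun y =>
    (hk.continuous_right y).measurable.aestronglyMeasurable
  -- the case of a relatively compact set of integration
  have key : ∀ C B : Set K, IsCompact C → MeasurableSet B → B ⊆ C → B ⊆ A →
      orliczNorm P μ (fun x => ∫ y in B, F y * k y x ∂μ) ≤ M * ∫⁻ y in B, ‖F y‖ₑ ∂μ := by
    intro C B hC hB hBC hBA
    have hI : ∫⁻ y in B, ‖F y‖ₑ ∂μ ≠ ∞ := hF.integrableOn.2.ne
    set I := ∫⁻ y in B, ‖F y‖ₑ ∂μ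
    refine ENNReal.le_of_forall_pos_le_add fun η hη _ => ?_
    obtain ⟨ε, hε0, hε⟩ := ENNReal.exists_nnreal_pos_mul_lt hI
      (ENNReal.coe_ne_zero.2 hη.ne')
    obtain ⟨n, y, S, hy, h⟩ := hk.exists_finite_rank_approx P (μ := μ) hC hB hBC
      (ENNReal.coe_ne_zero.2 hε0.ne')
    obtain ⟨h1, h2⟩ := h F hF.integrableOn
    have h3 : orliczNorm P μ (fun x => ∑ i, (∫ z in S i, F z ∂μ) * k (y i) x) ≤ M * I := by
      refine (orliczNorm_sum_le _ _ fun i => hkm _).trans ?_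
      refine le_trans ?_ (mul_le_mul_right h1 M)
      rw [Finset.mul_sum]
      refine Finset.sum_le_sum fun i _ => ?_
      rcases (S i).eq_empty_or_nonempty with h | h
      · simp [h]
      · rw [mul_comm]
        gcongr
        exact hM _ (hBA (hy i h))
    have h4 : (fun x => ∫ y in B, F y * k y x ∂μ) = fun x =>
        (∑ i, (∫ z in S i, F z ∂μ) * k (y i) x) +
        (∫ z in B, F z * k z x ∂μ - ∑ i, (∫ z in S i, F z ∂μ) * k (y i) x) := by
      ext x; ring
    rw [h4]
    refine (orliczNorm_add_le ?_).trans (add_le_add h3 (h2.trans hε.le))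
    exact Finset.aestronglyMeasurable_fun_sum _ fun i _ => (hkm _).const_mul _
  obtain ⟨C, hC, hCm, hC0⟩ := exists_isCompact_monotone_ae_eq_zero hF
  refine orliczNorm_le_of_ae_tendsto (F := fun n x => ∫ y in A ∩ C n, F y * k y x ∂μ)
    (fun n => (hk.continuous_integral hF.integrableOn).measurable.aestronglyMeasurable)
    (ae_of_all _ fun x => ?_) (Eventually.of_forall fun n => ?_)
  · have h1 : ∫ y in A, F y * k y x ∂μ = ∫ y in ⋃ n, A ∩ C n, F y * k y x ∂μ := by
      refine setIntegral_eq_of_subset_of_ae_sdiff_eq_zero hA.nullMeasurableSet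
        (Set.iUnion_subset fun n => Set.inter_subset_left) ?_
      filter_upwards [hC0] with y hy hyA
      rw [hy, zero_mul]
      intro h
      rw [← Set.inter_iUnion] at hyA
      exact hyA.2 ⟨hyA.1, h⟩
    rw [h1]
    exact tendsto_setIntegral_of_monotone (fun n => hA.inter (hC n).measurableSet)
      (fun i j hij => Set.inter_subset_inter_right _ (hCm hij))
      (hk.integrable_mul hF x).integrableOn
  · refine (key (C n) _ (hC n) (hA.inter (hC n).measurableSet) Set.inter_subset_right
      Set.inter_subset_left).trans ?_
    gcongr
    exact Set.inter_subset_left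

end IsProperKernel

/-! ### Completeness and compactness in weighted Orlicz spaces -/

/-- A set that is approximated, within every `ε`, by bounded combinations of finitely many vectors
is totally bounded. -/
theorem totallyBounded_of_finite_rank_approx {E : Type*} [SeminormedAddCommGroup E]
    [NormedSpace ℂ E] {s : Set E} (h : ∀ ε : ℝ, 0 < ε → ∃ (n : ℕ) (v : Fin n → E), ∀ x ∈ s,
      ∃ c : Fin n → ℂ, (∀ i, ‖c i‖ ≤ 1) ∧ ‖x - ∑ i, c i • v i‖ ≤ ε) : TotallyBounded s := by
  rw [Metric.totallyBounded_iff]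
  intro ε hε
  obtain ⟨n, v, hv⟩ := h (ε / 3) (by positivity)
  have hA : IsCompact ((fun c : Fin n → ℂ => ∑ i, c i • v i) ''
      Set.univ.pi fun _ => Metric.closedBall (0 : ℂ) 1) :=
    (isCompact_univ_pi fun _ => isCompact_closedBall 0 1).image (by fun_prop)
  obtain ⟨t, ht, htA⟩ := Metric.totallyBounded_iff.1 hA.totallyBounded (ε / 3) (by positivity)
  refine ⟨t, ht, fun x hx => ?_⟩
  obtain ⟨c, hc, hxc⟩ := hv x hx
  obtain ⟨y, hy, hyc⟩ := Set.mem_iUnion₂.1 (htA ⟨c, fun i _ => by simpa using hc i, rfl⟩)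
  refine Set.mem_iUnion₂.2 ⟨y, hy, ?_⟩
  rw [← dist_eq_norm] at hxc
  have := dist_triangle x (∑ i, c i • v i) y
  rw [Metric.mem_ball] at hyc ⊢
  linarith

namespace OrliczSpace

variable {K : Type*} [TopologicalSpace K] [MeasurableSpace K] [OpensMeasurableSpace K]
  {P : YoungPair} {μ : Measure K} {w : C(K, ℝ)}

/-- The class of a function `h` with `w h ∈ L^Φ`. -/
def ofFun (h : K → ℂ) (hm : AEStronglyMeasurable h μ)
    (hf : OrliczFinite P μ fun x => (w x : ℂ) * h x) : OrliczSpace P μ w :=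
  ⟨AEEqFun.mk h hm, hf.congr_ae (by
    filter_upwards [AEEqFun.coeFn_mk h hm] with x hx
    rw [hx])⟩

theorem rep_ofFun (h : K → ℂ) (hm : AEStronglyMeasurable h μ)
    (hf : OrliczFinite P μ fun x => (w x : ℂ) * h x) : (ofFun h hm hf).rep =ᵐ[μ] h :=
  AEEqFun.coeFn_mk h hm

theorem ext_rep {f g : OrliczSpace P μ w} (h : f.rep =ᵐ[μ] g.rep) : f = g :=
  Subtype.ext (AEEqFun.ext h)

theorem rep_sub (f g : OrliczSpace P μ w) : (f - g).rep =ᵐ[μ] f.rep - g.rep :=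
  AEEqFun.coeFn_sub _ _

theorem enorm_eq_of_rep {f : OrliczSpace P μ w} {h : K → ℂ}
    (hf : ∀ᵐ x ∂μ, (w x : ℂ) * f.rep x = h x) : ‖f‖ₑ = orliczNorm P μ h := by
  rw [← ofReal_norm, norm_def]
  exact (ENNReal.ofReal_toReal f.enorm'_ne_top).trans (orliczNorm_congr_ae hf)

theorem rep_sum {ι : Type*} (s : Finset ι) (f : ι → OrliczSpace P μ w) :
    (∑ i ∈ s, f i).rep =ᵐ[μ] fun x => ∑ i ∈ s, (f i).rep x := by
  classical
  induction s using Finset.induction_on with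
  | empty => exact rep_zero
  | insert a s ha ih =>
    rw [Finset.sum_insert ha]
    filter_upwards [rep_add (f a) (∑ i ∈ s, f i), ih] with x h1 h2
    rw [h1, Finset.sum_insert ha, Pi.add_apply, h2]

/-- The elements of `L^Φ_w` with σ-finite support. When `μ` is not σ-finite, `L^Φ_w` may contain
non-zero elements of norm zero, carried by sets that meet every set of finite measure in a null set;
this subspace excludes them and is complete. -/
def sigmaFinitePart (P : YoungPair) (μ : Measure K) (w : C(K, ℝ)) :
    Submodule ℂ (OrliczSpace P μ w) where
  carrier := {f | SigmaFinitelySupported μ f.rep}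
  zero_mem' := SigmaFinitelySupported.zero.congr_ae rep_zero.symm
  add_mem' := fun {f g} hf hg => hf.of_ae_imp hg (by
    filter_upwards [rep_add f g] with x hx h1 h2
    rw [hx, Pi.add_apply, h1, h2, add_zero])
  smul_mem' := fun c f hf => hf.of_ae_imp hf (by
    filter_upwards [rep_smul c f] with x hx h1 _
    rw [hx, Pi.smul_apply, h1, smul_zero])

/-- The Riesz–Fischer theorem for the σ-finitely supported part of `L^Φ_w`. -/
theorem completeSpace_sigmaFinitePart (hw : ∀ x, w x ≠ 0) :
    CompleteSpace (sigmaFinitePart P μ w) := by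
  refine Metric.complete_of_convergent_controlled_sequences (fun n => (1 / 2) ^ n) (by simp)
    fun u hu => ?_
  let B : ℕ → ℝ≥0∞ := fun n => ENNReal.ofReal ((1 / 2) ^ n)
  have hBsum : ∑' n, B n ≠ ∞ :=
    ((summable_geometric_of_lt_one (by norm_num) (by norm_num)).tsum_ofReal_lt_top).ne
  let φ : ℕ → K → ℂ := fun n x => (w x : ℂ) * (u n).1.rep x
  have hφm : ∀ n, AEStronglyMeasurable (φ n) μ := fun n => (u n).1.aesm
  have hφ : ∀ N n m, N ≤ n → N ≤ m → orliczNorm P μ (φ n - φ m) < B N := by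
    intro N n m hn hm
    have h1 := hu N n m hn hm
    rw [dist_eq_norm, ← ENNReal.ofReal_lt_ofReal_iff (by positivity), ofReal_norm] at h1
    refine lt_of_eq_of_lt ?_ h1
    refine (enorm_eq_of_rep (f := (u n).1 - (u m).1) ?_).symm
    filter_upwards [rep_sub (u n).1 (u m).1] with x hx
    rw [hx]
    simp only [Pi.sub_apply, φ, mul_sub]
  obtain ⟨S, hS, hμS, hS0⟩ := exists_common_sigmaFinite_support (μ := μ)
    (f := fun n => (u n).1.rep) fun n => (u n).2
  -- on each `S j` the sequence is Cauchy in `L¹`, fast enough to converge almost everywhere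
  have hconvS : ∀ j, ∀ᵐ x ∂μ, x ∈ S j → ∃ l, Tendsto (fun n => φ n x) atTop (𝓝 l) := by
    intro j
    rw [← ae_restrict_iff' (hS j)]
    obtain ⟨c, hc, hcS⟩ := exists_setLIntegral_le_orliczNorm P (hS j) (hμS j)
    refine Lp.ae_tendsto_of_cauchy_eLpNorm (p := 1) (B := fun n => (c + 1) * B n)
      (fun n => (hφm n).restrict) le_rfl ?_ fun N n m hn hm => ?_
    · rw [ENNReal.tsum_mul_left]
      exact ENNReal.mul_ne_top (by simp [hc]) hBsum
    · rw [eLpNorm_one_eq_lintegral_enorm]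
      calc ∫⁻ x in S j, ‖(φ n - φ m) x‖ₑ ∂μ ≤ c * orliczNorm P μ (φ n - φ m) := hcS _
        _ ≤ (c + 1) * orliczNorm P μ (φ n - φ m) := by gcongr; exact le_self_add
        _ < (c + 1) * B N := ENNReal.mul_lt_mul_right (by simp) (by simp [hc]) (hφ N n m hn hm)
  have hconv : ∀ᵐ x ∂μ, ∃ l, Tendsto (fun n => φ n x) atTop (𝓝 l) := by
    filter_upwards [ae_all_iff.2 hconvS, hS0] with x hx hx0
    by_cases hxS : x ∈ ⋃ n, S n
    · obtain ⟨j, hj⟩ := Set.mem_iUnion.1 hxS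
      exact hx j hj
    · exact ⟨0, by simp [φ, hx0 hxS]⟩
  obtain ⟨h, hhm, hlim⟩ := exists_stronglyMeasurable_limit_of_tendsto_ae hφm hconv
  have hhN : ∀ N, orliczNorm P μ (fun x => h x - φ N x) ≤ B N := fun N =>
    orliczNorm_le_of_ae_tendsto (F := fun n => φ n - φ N) (fun n => (hφm n).sub (hφm N))
      (hlim.mono fun x hx => hx.sub_const _)
      ((eventually_ge_atTop N).mono fun n hn => (hφ N n N hn le_rfl).le)
  have hhs : SigmaFinitelySupported μ h := by
    refine ⟨S, hS, hμS, ?_⟩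
    filter_upwards [hlim, hS0] with x hx hx0 hxS
    refine tendsto_nhds_unique hx ?_
    simp [φ, hx0 hxS]
  have hhfin : orliczNorm P μ h < ∞ := by
    have h1 : h = fun x => (h x - φ 0 x) + φ 0 x := by ext x; ring
    rw [h1]
    refine (orliczNorm_add_le (hhm.aestronglyMeasurable.sub (hφm 0))).trans_lt
      (ENNReal.add_lt_top.2 ⟨(hhN 0).trans_lt ENNReal.ofReal_lt_top, ?_⟩)
    exact orliczNorm_lt_top (u 0).1.finite
  have hwh : ∀ x, (w x : ℂ) * (((w x)⁻¹ : ℝ) * h x) = h x := fun x => by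
    rw [← mul_assoc, ← Complex.ofReal_mul, mul_inv_cancel₀ (hw x), Complex.ofReal_one, one_mul]
  have hm : AEStronglyMeasurable (fun x => (((w x)⁻¹ : ℝ) : ℂ) * h x) μ :=
    (Complex.measurable_ofReal.comp w.continuous.measurable.inv).aestronglyMeasurable.mul
      hhm.aestronglyMeasurable
  have hfin := orliczFinite_of_orliczNorm_lt_top hhm.aestronglyMeasurable hhs hhfin
  let f : OrliczSpace P μ w := ofFun _ hm (by simpa only [hwh] using hfin)
  have hfrep : f.rep =ᵐ[μ] _ := rep_ofFun _ hm _
  have hf : SigmaFinitelySupported μ f.rep := hhs.of_ae_imp hhs (by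
    filter_upwards [hfrep] with x hx h0 _
    rw [hx, h0, mul_zero])
  refine ⟨⟨f, hf⟩, ?_⟩
  rw [tendsto_iff_dist_tendsto_zero]
  refine squeeze_zero (fun _ => dist_nonneg) (fun n => ?_)
    (tendsto_pow_atTop_nhds_zero_of_lt_one (r := 1 / 2) (by norm_num) (by norm_num))
  rw [dist_comm, dist_eq_norm, ← ENNReal.ofReal_le_ofReal_iff (by positivity), ofReal_norm]
  refine le_of_eq_of_le ?_ (hhN n)
  refine enorm_eq_of_rep (f := f - (u n).1) ?_
  filter_upwards [rep_sub f (u n).1, hfrep] with x hx hx1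
  rw [hx, Pi.sub_apply, mul_sub, hx1, hwh]

theorem isCompactOperator_of_totallyBounded {X : Type*} [SeminormedAddCommGroup X] [NormedSpace ℂ X]
    (hw : ∀ x, w x ≠ 0) (T : X →L[ℂ] OrliczSpace P μ w)
    (hT : ∀ f, SigmaFinitelySupported μ (T f).rep)
    (htb : TotallyBounded (T '' Metric.closedBall 0 1)) : IsCompactOperator T := by
  have := completeSpace_sigmaFinitePart (P := P) (μ := μ) hw
  let A : Set (sigmaFinitePart P μ w) := Subtype.val ⁻¹' (T '' Metric.closedBall 0 1)
  have hA : TotallyBounded A := totallyBounded_preimage isUniformEmbedding_subtype_val.1 htb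
  have hAc : IsCompact (closure A) := hA.closure.isCompact_of_isClosed isClosed_closure
  refine ⟨_, hAc.image continuous_subtype_val,
    mem_of_superset (Metric.closedBall_mem_nhds (0 : X) one_pos) fun f hf => ?_⟩
  exact ⟨⟨T f, hT f⟩, subset_closure ⟨f, hf, rfl⟩, rfl⟩

end OrliczSpace

/-- An element of `L^Φ_w` whose restrictions to all compact sets have norm zero has norm zero. -/
theorem OrliczSpace.enorm_eq_zero_of_isCompact {K : Type*} [TopologicalSpace K] [T2Space K]
    [MeasurableSpace K] [BorelSpace K] {P : YoungPair} {μ : Measure K} [μ.Regular] {w : C(K, ℝ)}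
    (h : OrliczSpace P μ w)
    (hh : ∀ D, IsCompact D → orliczNorm P μ
      (D.indicator fun x => (w x : ℂ) * h.rep x) = 0) : ‖h‖ₑ = 0 := by
  rw [enorm_eq_of_rep (ae_of_all _ fun _ => rfl)]
  refine le_antisymm (iSup_le fun v => iSup_le fun hv => iSup_le fun hv1 => ?_) zero_le
  -- the pairing is integrable, hence carried by a σ-compact set
  have hint : Integrable (fun x => (w x : ℂ) * h.rep x * v x) μ :=
    ⟨h.aesm.mul hv.aestronglyMeasurable,
      (le_orliczNorm hv hv1).trans_lt (orliczNorm_lt_top h.finite)⟩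
  obtain ⟨C, hC, -, hC0⟩ := exists_isCompact_monotone_ae_eq_zero hint
  have h1 : ∀ n, ∀ᵐ x ∂μ, x ∈ C n → (w x : ℂ) * h.rep x * v x = 0 := fun n => by
    have h2 := le_orliczNorm (P := P) (f := (C n).indicator fun x => (w x : ℂ) * h.rep x) hv hv1
    have hm : AEMeasurable
        (fun x => ‖(C n).indicator (fun x => (w x : ℂ) * h.rep x) x * v x‖ₑ) μ :=
      ((h.aesm.indicator (hC n).measurableSet).mul hv.aestronglyMeasurable).enorm
    rw [hh _ (hC n), nonpos_iff_eq_zero, lintegral_eq_zero_iff' hm] at h2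
    filter_upwards [h2] with x hx hxC
    simpa [hxC] using hx
  refine (lintegral_eq_zero_of_ae_eq_zero ?_).le
  filter_upwards [ae_all_iff.2 h1, hC0] with x hx hx0
  rw [Pi.zero_apply, enorm_eq_zero]
  by_cases hxC : x ∈ ⋃ n, C n
  · obtain ⟨n, hn⟩ := Set.mem_iUnion.1 hxC
    exact hx n hn
  · exact hx0 hxC

/-! ### The convolution operator on the weighted `L¹` space -/

section WeightedL1

variable {K : Type*} [TopologicalSpace K] [MeasurableSpace K] [OpensMeasurableSpace K]
  {μ : Measure K} {w : C(K, ℝ)}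

theorem WeightedL1.integrable (hw : ∀ x, 0 < w x) (f : WeightedL1 μ w) :
    Integrable (fun y => (w y : ℂ) * f y) μ := by
  have h := (integrable_withDensity_iff_integrable_smul'
    w.continuous.measurable.ennreal_ofReal (ae_of_all _ fun _ => ENNReal.ofReal_lt_top)).1
    (L1.integrable_coeFn f)
  refine h.congr (ae_of_all _ fun y => ?_)
  simp only [ENNReal.toReal_ofReal (hw y).le, Complex.real_smul]

theorem WeightedL1.lintegral_enorm (hw : ∀ x, 0 < w x) (f : WeightedL1 μ w) :
    ∫⁻ y, ‖(w y : ℂ) * f y‖ₑ ∂μ = ‖f‖ₑ := by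
  rw [Lp.enorm_def, eLpNorm_one_eq_lintegral_enorm, lintegral_withDensity_eq_lintegral_mul₀'
    w.continuous.measurable.ennreal_ofReal.aemeasurable (Lp.aestronglyMeasurable f).enorm]
  refine lintegral_congr fun y => ?_
  rw [Pi.mul_apply, enorm_mul, ← ofReal_norm (w y : ℂ), Complex.norm_real,
    Real.norm_of_nonneg (hw y).le]

theorem absolutelyContinuous_withDensity_weight (hw : ∀ x, 0 < w x) :
    μ ≪ μ.withDensity fun x => ENNReal.ofReal (w x) :=
  withDensity_absolutelyContinuous' w.continuous.measurable.ennreal_ofReal.aemeasurable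
    (ae_of_all _ fun x => (ENNReal.ofReal_pos.2 (hw x)).ne')

end WeightedL1

namespace Hypergroup

/-- The kernel `(y, x) ↦ w(x) (L_y g)(x) / w(y)`, which represents `f ↦ w (f * g)` as an integral
operator acting on `w f`. -/
def weightedKernel {K : Type*} [TopologicalSpace K] [MeasurableSpace K] [OpensMeasurableSpace K]
    (H : Hypergroup K) (w : C(K, ℝ)) (g : K → ℂ) (y x : K) : ℂ :=
  (w x : ℂ) * (H.leftTranslate y g x * ((w y)⁻¹ : ℝ))

section

variable {K : Type*} [TopologicalSpace K] [MeasurableSpace K] [OpensMeasurableSpace K]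
  {H : Hypergroup K} {μ : Measure K} {w : C(K, ℝ)} {g : K → ℂ} {P : YoungPair}

theorem orliczNorm_weightedKernel (hw : ∀ x, 0 < w x) (y : K) :
    orliczNorm P μ (H.weightedKernel w g y) =
      orliczNorm P μ (fun x => (w x : ℂ) * H.leftTranslate y g x) / ENNReal.ofReal (w y) := by
  have h : H.weightedKernel w g y = fun x =>
      (((w y)⁻¹ : ℝ) : ℂ) * ((w x : ℂ) * H.leftTranslate y g x) := by
    ext x; simp only [weightedKernel]; ring
  rw [h, orliczNorm_const_mul, ← ofReal_norm, Complex.norm_real,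
    Real.norm_of_nonneg (inv_pos.2 (hw y)).le, ENNReal.ofReal_inv_of_pos (hw y), mul_comm,
    ENNReal.div_eq_inv_mul, mul_comm]

theorem mul_weightedKernel (hw : ∀ x, 0 < w x) (f : K → ℂ) (y x : K) :
    (w y : ℂ) * f y * H.weightedKernel w g y x = (w x : ℂ) * (f y * H.ev g (H.inv y) x) := by
  have h : (w y : ℂ) ≠ 0 := Complex.ofReal_ne_zero.2 (hw y).ne'
  simp only [weightedKernel, leftTranslate, Complex.ofReal_inv]
  field_simp

theorem mul_conv (hw : ∀ x, 0 < w x) (f : K → ℂ) (x : K) :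
    (w x : ℂ) * H.conv μ f g x = ∫ y, ((w y : ℂ) * f y) * H.weightedKernel w g y x ∂μ := by
  simp only [conv, mul_weightedKernel hw, integral_const_mul]

theorem continuous_leftTranslate [R1Space K] (hg : Continuous g) (hgc : HasCompactSupport g) :
    Continuous fun p : K × K => H.leftTranslate p.1 g p.2 :=
  (H.continuous_ev hg hgc).comp (by fun_prop : Continuous fun p : K × K => (H.inv p.1, p.2))

theorem conv_congr {f f' : K → ℂ} (h : f =ᵐ[μ] f') (x : K) :
    H.conv μ f g x = H.conv μ f' g x :=
  integral_congr_ae (h.mono fun y hy => by simp only [hy])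

theorem conv_add {f f' : K → ℂ} {x : K} (h : H.ConvExistsAt μ f g x)
    (h' : H.ConvExistsAt μ f' g x) :
    H.conv μ (f + f') g x = H.conv μ f g x + H.conv μ f' g x := by
  simp only [conv, Pi.add_apply, add_mul]
  exact integral_add h h'

theorem conv_smul (c : ℂ) (f : K → ℂ) (x : K) :
    H.conv μ (c • f) g x = c * H.conv μ f g x := by
  simp only [conv, Pi.smul_apply, smul_eq_mul, _root_.mul_assoc, integral_const_mul]

end

section

variable {K : Type*} [TopologicalSpace K] [T2Space K] [LocallyCompactSpace K]
  [MeasurableSpace K] [BorelSpace K] {H : Hypergroup K} {μ : Measure K} {w : C(K, ℝ)}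
  {g : K → ℂ} {P : YoungPair}

theorem isProperKernel_weightedKernel (hw : ∀ x, 0 < w x) (hg : Continuous g)
    (hgc : HasCompactSupport g) : IsProperKernel (H.weightedKernel w g) where
  continuous := by
    refine (Complex.continuous_ofReal.comp (w.continuous.comp continuous_snd)).mul
      ((continuous_leftTranslate hg hgc).mul (Complex.continuous_ofReal.comp
        ((w.continuous.comp continuous_fst).inv₀ fun p => (hw p.1).ne')))
  exists_right C hC := by
    obtain ⟨D, hD, h⟩ := H.exists_isCompact_leftTranslate_eq_zero hgc hC
    exact ⟨D, hD, fun y hy x hx => by simp [weightedKernel, h y hy x hx]⟩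
  exists_left D hD := by
    obtain ⟨C, hC, h⟩ := H.exists_isCompact_leftTranslate_eq_zero' hgc hD
    exact ⟨C, hC, fun x hx y hy => by simp [weightedKernel, h x hx y hy]⟩

theorem convExistsAt (hw : ∀ x, 0 < w x) (hg : Continuous g) (hgc : HasCompactSupport g)
    {f : K → ℂ} (hf : Integrable (fun y => (w y : ℂ) * f y) μ) (x : K) :
    H.ConvExistsAt μ f g x := by
  have h := ((isProperKernel_weightedKernel (H := H) hw hg hgc).integrable_mul hf x).const_mul
    (w x : ℂ)⁻¹
  have hx : (w x : ℂ) ≠ 0 := Complex.ofReal_ne_zero.2 (hw x).ne'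
  simp only [mul_weightedKernel hw, inv_mul_cancel_left₀ hx] at h
  exact h

theorem aestronglyMeasurable_conv (hw : ∀ x, 0 < w x) (hg : Continuous g)
    (hgc : HasCompactSupport g) {f : K → ℂ} (hf : Integrable (fun y => (w y : ℂ) * f y) μ) :
    AEStronglyMeasurable (H.conv μ f g) μ := by
  have h := (isProperKernel_weightedKernel (H := H) hw hg hgc).continuous_integral hf
  have h1 : H.conv μ f g = fun x =>
      (w x : ℂ)⁻¹ * ∫ y, ((w y : ℂ) * f y) * H.weightedKernel w g y x ∂μ := by
    ext x
    rw [← mul_conv hw, inv_mul_cancel_left₀ (Complex.ofReal_ne_zero.2 (hw x).ne')]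
  rw [h1]
  refine Measurable.aestronglyMeasurable (Continuous.measurable ?_)
  exact ((Complex.continuous_ofReal.comp w.continuous).inv₀
    fun x => Complex.ofReal_ne_zero.2 (hw x).ne').mul h

variable [μ.Regular]

theorem sigmaFinitelySupported_mul_conv (hw : ∀ x, 0 < w x) (hg : Continuous g)
    (hgc : HasCompactSupport g) {f : K → ℂ} (hf : Integrable (fun y => (w y : ℂ) * f y) μ) :
    SigmaFinitelySupported μ fun x => (w x : ℂ) * H.conv μ f g x := by
  simp only [mul_conv hw]
  exact (isProperKernel_weightedKernel hw hg hgc).sigmaFinitelySupported_integral hf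

theorem orliczNorm_mul_conv_le (hw : ∀ x, 0 < w x) (hg : Continuous g)
    (hgc : HasCompactSupport g) {M : ℝ≥0∞} (hM : ∀ y, orliczNorm P μ (H.weightedKernel w g y) ≤ M)
    (f : WeightedL1 μ w) :
    orliczNorm P μ (fun x => (w x : ℂ) * H.conv μ f g x) ≤ M * ‖f‖ₑ := by
  have h := (isProperKernel_weightedKernel hw hg hgc).orliczNorm_integral_le MeasurableSet.univ
    (fun y _ => hM y) (WeightedL1.integrable hw f)
  simp only [setLIntegral_univ, setIntegral_univ, WeightedL1.lintegral_enorm hw] at h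
  simpa only [mul_conv hw] using h

/-- When the norms `‖L_y g‖_{Φ,w} / w(y)` are bounded, `f ↦ f * g` is a bounded operator from `L¹_w`
to `L^Φ_w`. -/
theorem exists_convolution_operator (hw : ∀ x, 0 < w x) (hg : Continuous g)
    (hgc : HasCompactSupport g) {M : ℝ≥0∞} (hMtop : M ≠ ∞)
    (hM : ∀ y, orliczNorm P μ (H.weightedKernel w g y) ≤ M) :
    ∃ T : WeightedL1 μ w →L[ℂ] OrliczSpace P μ w, ∀ f, (T f).rep =ᵐ[μ] H.conv μ f g := by
  have hfin : ∀ f : WeightedL1 μ w, OrliczFinite P μ fun x => (w x : ℂ) * H.conv μ f g x :=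
    fun f => by
      have hf := WeightedL1.integrable hw f
      refine orliczFinite_of_orliczNorm_lt_top
        ((Complex.measurable_ofReal.comp w.continuous.measurable).aestronglyMeasurable.mul
          (aestronglyMeasurable_conv hw hg hgc hf))
        (sigmaFinitelySupported_mul_conv hw hg hgc hf)
        ((orliczNorm_mul_conv_le hw hg hgc hM f).trans_lt ?_)
      exact ENNReal.mul_lt_top hMtop.lt_top enorm_lt_top
  let T₀ : WeightedL1 μ w → OrliczSpace P μ w := fun f =>
    OrliczSpace.ofFun (H.conv μ f g)
      (aestronglyMeasurable_conv hw hg hgc (WeightedL1.integrable hw f)) (hfin f)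
  have hrep : ∀ f, (T₀ f).rep =ᵐ[μ] H.conv μ f g := fun f => OrliczSpace.rep_ofFun _ _ _
  have hac := absolutelyContinuous_withDensity_weight (μ := μ) hw
  let T₁ : WeightedL1 μ w →ₗ[ℂ] OrliczSpace P μ w :=
    { toFun := T₀
      map_add' := fun f f' => OrliczSpace.ext_rep (by
        filter_upwards [hrep (f + f'), hrep f, hrep f', OrliczSpace.rep_add (T₀ f) (T₀ f')]
          with x h1 h2 h3 h4
        rw [h1, h4, Pi.add_apply, h2, h3, conv_congr (hac.ae_le (Lp.coeFn_add f f')), conv_add]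
        · exact convExistsAt hw hg hgc (WeightedL1.integrable hw f) x
        · exact convExistsAt hw hg hgc (WeightedL1.integrable hw f') x)
      map_smul' := fun c f => OrliczSpace.ext_rep (by
        filter_upwards [hrep (c • f), hrep f, OrliczSpace.rep_smul c (T₀ f)] with x h1 h2 h3
        rw [RingHom.id_apply, h1, h3, Pi.smul_apply, h2, conv_congr (hac.ae_le (Lp.coeFn_smul c f)),
          conv_smul, smul_eq_mul]) }
  refine ⟨T₁.mkContinuous M.toReal fun f => ?_, hrep⟩
  rw [← ENNReal.ofReal_le_ofReal_iff (by positivity), ofReal_norm,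
    ENNReal.ofReal_mul ENNReal.toReal_nonneg, ENNReal.ofReal_toReal hMtop, ofReal_norm]
  refine le_of_eq_of_le (OrliczSpace.enorm_eq_of_rep ?_) (orliczNorm_mul_conv_le hw hg hgc hM f)
  filter_upwards [hrep f] with x hx
  rw [← hx]; rfl

/-- The normalized translate `L_y g / w(y)` as an element of `L^Φ_w`. -/
def normalizedTranslate (P : YoungPair) (μ : Measure K) [μ.Regular] (hw : ∀ x, 0 < w x)
    (hg : Continuous g) (hgc : HasCompactSupport g) (y : K) : OrliczSpace P μ w :=
  OrliczSpace.ofFun (fun x => H.leftTranslate y g x * ((w y)⁻¹ : ℝ))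
    (((continuous_leftTranslate hg hgc).comp (by fun_prop : Continuous fun x => (y, x))).mul
      continuous_const).measurable.aestronglyMeasurable
    ((isProperKernel_weightedKernel (H := H) hw hg hgc).orliczFinite P y)

theorem mul_rep_normalizedTranslate (hw : ∀ x, 0 < w x) (hg : Continuous g)
    (hgc : HasCompactSupport g) (y : K) :
    ∀ᵐ x ∂μ, (w x : ℂ) * (normalizedTranslate (H := H) P μ hw hg hgc y).rep x =
      H.weightedKernel w g y x := by
  filter_upwards [OrliczSpace.rep_ofFun (P := P) (μ := μ) (w := w)
    (fun x => H.leftTranslate y g x * ((w y)⁻¹ : ℝ)) _ _] with x hx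
  rw [weightedKernel, ← hx]; rfl

end

end Hypergroup

/-! ### Compactness of the convolution operator -/

namespace Hypergroup

section

variable {K : Type*} [TopologicalSpace K] [T2Space K] [LocallyCompactSpace K]
  [MeasurableSpace K] [BorelSpace K] {H : Hypergroup K} {μ : Measure K} [μ.Regular] {w : C(K, ℝ)}
  {g : K → ℂ} {P : YoungPair}

/-- If `‖L_y g‖_{Φ,w} / w(y)` vanishes at infinity, the convolution operator is compact: over a
large compact set it is nearly of finite rank, and the contribution of the complement is small. -/
theorem isCompactOperator_of_tendsto (hw : ∀ x, 0 < w x) (hg : Continuous g)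
    (hgc : HasCompactSupport g)
    (h0 : Tendsto (fun y => orliczNorm P μ (H.weightedKernel w g y)) (cocompact K) (𝓝 0))
    (T : WeightedL1 μ w →L[ℂ] OrliczSpace P μ w) (hT : ∀ f, (T f).rep =ᵐ[μ] H.conv μ f g) :
    IsCompactOperator T := by
  have hk := isProperKernel_weightedKernel (H := H) hw hg hgc
  refine OrliczSpace.isCompactOperator_of_totallyBounded (fun x => (hw x).ne') T (fun f => ?_)
    (totallyBounded_of_finite_rank_approx fun ε hε => ?_)
  · have h1 := sigmaFinitelySupported_mul_conv (H := H) hw hg hgc (WeightedL1.integrable hw f)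
    refine h1.of_ae_imp h1 ?_
    filter_upwards [hT f] with x hx h2 _
    rw [hx]
    exact (mul_eq_zero.1 h2).resolve_left (Complex.ofReal_ne_zero.2 (hw x).ne')
  have hε2 : ENNReal.ofReal (ε / 2) ≠ 0 := (ENNReal.ofReal_pos.2 (half_pos hε)).ne'
  obtain ⟨C, hC, hCε⟩ := mem_cocompact.1 (h0.eventually_le_const (pos_iff_ne_zero.2 hε2))
  have hCm := hC.measurableSet
  obtain ⟨n, y, S, -, hS⟩ := hk.exists_finite_rank_approx P (μ := μ) hC hCm subset_rfl hε2
  refine ⟨n, fun i => normalizedTranslate (H := H) P μ hw hg hgc (y i), ?_⟩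
  rintro _ ⟨f, hf, rfl⟩
  have hf1 : ‖f‖ₑ ≤ 1 := by
    rw [← ofReal_norm]
    exact ENNReal.ofReal_le_one.2 (by simpa using hf)
  have hF := WeightedL1.integrable hw f
  have hFn := WeightedL1.lintegral_enorm hw f
  have hFA : ∀ A : Set K, ∫⁻ z in A, ‖(w z : ℂ) * f z‖ₑ ∂μ ≤ 1 := fun A =>
    (setLIntegral_le_lintegral _ _).trans (hFn.trans_le hf1)
  obtain ⟨hS1, hS2⟩ := hS _ hF.integrableOn
  set c : Fin n → ℂ := fun i => ∫ z in S i, (w z : ℂ) * f z ∂μ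
  refine ⟨c, fun i => ?_, ?_⟩
  · rw [← ENNReal.ofReal_le_ofReal_iff zero_le_one, ofReal_norm, ENNReal.ofReal_one]
    exact (Finset.single_le_sum (f := fun i => ‖c i‖ₑ) (fun _ _ => zero_le)
      (Finset.mem_univ i)).trans (hS1.trans (hFA C))
  · rw [← ENNReal.ofReal_le_ofReal_iff hε.le, ofReal_norm]
    have hrep : ∀ᵐ x ∂μ, (w x : ℂ) *
        (T f - ∑ i, c i • normalizedTranslate (H := H) P μ hw hg hgc (y i)).rep x =
        (∫ z in C, ((w z : ℂ) * f z) * H.weightedKernel w g z x ∂μ -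
          ∑ i, c i * H.weightedKernel w g (y i) x) +
        ∫ z in Cᶜ, ((w z : ℂ) * f z) * H.weightedKernel w g z x ∂μ := by
      filter_upwards [hT f, OrliczSpace.rep_sub (T f)
          (∑ i, c i • normalizedTranslate (H := H) P μ hw hg hgc (y i)),
        OrliczSpace.rep_sum Finset.univ
          fun i => c i • normalizedTranslate (H := H) P μ hw hg hgc (y i),
        ae_all_iff.2 fun i => OrliczSpace.rep_smul (c i)
          (normalizedTranslate (H := H) P μ hw hg hgc (y i)),
        ae_all_iff.2 fun i =>
          mul_rep_normalizedTranslate (H := H) (P := P) (μ := μ) hw hg hgc (y i)]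
        with x h1 h2 h3 h4 h5
      rw [h2, Pi.sub_apply, h1, h3, mul_sub, mul_conv hw, Finset.mul_sum,
        ← integral_add_compl hCm (hk.integrable_mul hF x)]
      have h6 : ∑ i, (w x : ℂ) *
          (c i • normalizedTranslate (H := H) P μ hw hg hgc (y i)).rep x =
          ∑ i, c i * H.weightedKernel w g (y i) x :=
        Finset.sum_congr rfl fun i _ => by
          rw [h4, Pi.smul_apply, smul_eq_mul, ← h5]; ring
      rw [h6]; ring
    rw [OrliczSpace.enorm_eq_of_rep hrep]
    refine (orliczNorm_add_le ?_).trans ?_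
    · exact ((hk.continuous_integral hF.integrableOn).sub (continuous_finsetSum _ fun i _ =>
        continuous_const.mul (hk.continuous_right (y i)))).measurable.aestronglyMeasurable
    · have h1 := hk.orliczNorm_integral_le (P := P) hCm.compl (fun z hz => hCε hz) hF
      calc _ ≤ ENNReal.ofReal (ε / 2) * 1 + ENNReal.ofReal (ε / 2) * 1 :=
            add_le_add (hS2.trans (by gcongr; exact hFA C)) (h1.trans (by gcongr; exact hFA Cᶜ))
        _ = ENNReal.ofReal ε := by
            rw [_root_.mul_one, ← ENNReal.ofReal_add (by positivity) (by positivity), add_halves]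

/-- The normalized translates are limits of images of the unit ball: convolve with normalized
indicators of small neighbourhoods of `y`. -/
theorem normalizedTranslate_mem_closure [μ.IsOpenPosMeasure] (hw : ∀ x, 0 < w x)
    (hg : Continuous g) (hgc : HasCompactSupport g)
    (T : WeightedL1 μ w →L[ℂ] OrliczSpace P μ w) (hT : ∀ f, (T f).rep =ᵐ[μ] H.conv μ f g) (y : K) :
    normalizedTranslate (H := H) P μ hw hg hgc y ∈ closure (T '' Metric.closedBall 0 1) := by
  have hk := isProperKernel_weightedKernel (H := H) hw hg hgc
  rw [Metric.mem_closure_iff]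
  intro ε hε
  obtain ⟨C, hC, hCy⟩ := exists_compact_mem_nhds y
  obtain ⟨D, hD, hCD⟩ := hk.exists_right C hC
  obtain ⟨δ, hδ, hδε⟩ := exists_orliczNorm_le_mul_of_isCompact P (μ := μ) hD
    (ENNReal.ofReal_pos.2 (half_pos hε)).ne'
  obtain ⟨U, hU, hUo, hyU⟩ := eventually_nhds_iff.1
    ((hk.eventually_norm_sub_le y hδ).and hCy)
  have hUm := hUo.measurableSet
  set ν := μ.withDensity fun x => ENNReal.ofReal (w x)
  -- the weighted measure of `U` is positive and finite
  have hνtop : ν U ≠ ∞ := by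
    have h1 : ∫⁻ x in C, ENNReal.ofReal (w x) ∂μ < ∞ := by
      have h2 := (w.continuous.continuousOn.integrableOn_compact hC (μ := μ)).2
      refine lt_of_le_of_lt (lintegral_mono fun x => ?_) h2
      rw [← Real.enorm_of_nonneg (hw x).le]
    refine (lt_of_le_of_lt ?_ h1).ne
    rw [withDensity_apply _ hUm]
    exact lintegral_mono_set fun x hx => (hU x hx).2
  have hνpos : ν U ≠ 0 := fun h =>
    (hUo.measure_pos μ ⟨y, hyU⟩).ne' (absolutelyContinuous_withDensity_weight hw h)
  set m := (ν U).toReal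
  have hm : 0 < m := ENNReal.toReal_pos hνpos hνtop
  let f : WeightedL1 μ w := indicatorConstLp 1 hUm hνtop ((m⁻¹ : ℝ) : ℂ)
  have hfn : ‖f‖ = 1 := by
    rw [norm_indicatorConstLp one_ne_zero ENNReal.one_ne_top, Complex.norm_real,
      Real.norm_of_nonneg (inv_pos.2 hm).le]
    simp only [ENNReal.toReal_one, div_one, Real.rpow_one]
    exact inv_mul_cancel₀ hm.ne'
  have hfe : ‖f‖ₑ = 1 := by rw [← ofReal_norm, hfn, ENNReal.ofReal_one]
  have hF := WeightedL1.integrable hw f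
  have hFn := WeightedL1.lintegral_enorm hw f
  have hfU : ∀ᵐ z ∂μ, f z = U.indicator (fun _ => ((m⁻¹ : ℝ) : ℂ)) z :=
    (absolutelyContinuous_withDensity_weight hw).ae_le indicatorConstLp_coeFn
  -- the mass of `w f` is one
  have hF1 : ∫ z, (w z : ℂ) * f z ∂μ = 1 := by
    have h1 : ∫ z, (w z : ℂ) * f z ∂μ = ((∫ z, ‖(w z : ℂ) * f z‖ ∂μ : ℝ) : ℂ) := by
      rw [← integral_complex_ofReal]
      refine integral_congr_ae ?_
      filter_upwards [hfU] with z hz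
      rw [hz]
      by_cases hzU : z ∈ U
      · rw [Set.indicator_of_mem hzU, norm_mul, Complex.norm_real, Complex.norm_real,
          Real.norm_of_nonneg (hw z).le, Real.norm_of_nonneg (inv_pos.2 hm).le, Complex.ofReal_mul]
      · simp [hzU]
    rw [h1, integral_norm_eq_lintegral_enorm hF.1, hFn, hfe, ENNReal.toReal_one,
      Complex.ofReal_one]
  refine ⟨T f, ⟨f, by simp [hfn], rfl⟩, ?_⟩
  rw [dist_comm, dist_eq_norm]
  refine lt_of_le_of_lt ?_ (half_lt_self hε)
  rw [← ENNReal.ofReal_le_ofReal_iff (by positivity), ofReal_norm]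
  have hrep : ∀ᵐ x ∂μ, (w x : ℂ) *
      (T f - normalizedTranslate (H := H) P μ hw hg hgc y).rep x =
      ∫ z, ((w z : ℂ) * f z) * (H.weightedKernel w g z x - H.weightedKernel w g y x) ∂μ := by
    filter_upwards [hT f, OrliczSpace.rep_sub (T f) (normalizedTranslate (H := H) P μ hw hg hgc y),
      mul_rep_normalizedTranslate (H := H) (P := P) (μ := μ) hw hg hgc y] with x h1 h2 h3
    simp only [mul_sub (_ * _) _ (H.weightedKernel w g y x)]
    rw [h2, Pi.sub_apply, mul_sub, h1, h3, mul_conv hw,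
      integral_sub (hk.integrable_mul hF x) (hF.mul_const _), integral_mul_const, hF1,
      _root_.one_mul]
  rw [OrliczSpace.enorm_eq_of_rep hrep, ← _root_.mul_one (ENNReal.ofReal (ε / 2))]
  refine hδε _ _ ENNReal.one_ne_top (fun x hx => ?_) fun x => ?_
  · refine integral_eq_zero_of_ae ?_
    filter_upwards [hfU] with z hz
    by_cases hzU : z ∈ U
    · rw [hCD z (hU z hzU).2 x hx, hCD y (mem_of_mem_nhds hCy) x hx, sub_zero, mul_zero,
        Pi.zero_apply]
    · rw [hz, Set.indicator_of_notMem hzU, mul_zero, zero_mul, Pi.zero_apply]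
  · refine (enorm_integral_le_lintegral_enorm _).trans ?_
    have hδ1 : ENNReal.ofReal δ * 1 = ∫⁻ z, ENNReal.ofReal δ * ‖(w z : ℂ) * f z‖ₑ ∂μ := by
      rw [lintegral_const_mul' _ _ ENNReal.ofReal_ne_top, hFn, hfe]
    rw [hδ1]
    refine lintegral_mono_ae ?_
    filter_upwards [hfU] with z hz
    by_cases hzU : z ∈ U
    · rw [enorm_mul, mul_comm]
      gcongr
      rw [← ofReal_norm]
      exact ENNReal.ofReal_le_ofReal ((hU z hzU).1 x)
    · rw [hz, Set.indicator_of_notMem hzU, mul_zero, zero_mul, enorm_zero]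
      exact zero_le

/-- If the convolution operator is compact, `‖L_y g‖_{Φ,w} / w(y)` vanishes at infinity: a norm
limit of normalized translates along `y → ∞` has norm zero, as `L_y g` eventually vanishes on each
compact set. -/
theorem tendsto_of_isCompactOperator [μ.IsOpenPosMeasure] (hw : ∀ x, 0 < w x)
    (hg : Continuous g) (hgc : HasCompactSupport g)
    (T : WeightedL1 μ w →L[ℂ] OrliczSpace P μ w) (hT : ∀ f, (T f).rep =ᵐ[μ] H.conv μ f g)
    (hTc : IsCompactOperator T) :
    Tendsto (fun y => orliczNorm P μ (H.weightedKernel w g y)) (cocompact K) (𝓝 0) := by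
  have hk := isProperKernel_weightedKernel (H := H) hw hg hgc
  set G := normalizedTranslate (H := H) P μ hw hg hgc
  have hG : ∀ y, ‖G y‖ₑ = orliczNorm P μ (H.weightedKernel w g y) := fun y =>
    OrliczSpace.enorm_eq_of_rep (mul_rep_normalizedTranslate hw hg hgc y)
  simp only [← hG]
  obtain ⟨A, hA, hTA⟩ := hTc.image_closedBall_subset_compact (f := T.toLinearMap) 1
  have hGA : ∀ y, G y ∈ closure A := fun y =>
    closure_mono hTA (normalizedTranslate_mem_closure hw hg hgc T hT y)
  rw [tendsto_iff_ultrafilter]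
  intro 𝓤 h𝓤
  obtain ⟨h, -, hlim⟩ := hA.closure.ultrafilter_le_nhds (𝓤.map G)
    (tendsto_principal.2 (Eventually.of_forall hGA))
  have hlim : Tendsto G 𝓤 (𝓝 h) := hlim
  have hlim0 : Tendsto (fun y => ‖h - G y‖ₑ) 𝓤 (𝓝 0) := by
    have h1 := (tendsto_const_nhds.sub hlim : Tendsto (fun y => h - G y) 𝓤 (𝓝 (h - h))).enorm
    rwa [sub_self, ← ofReal_norm, norm_zero, ENNReal.ofReal_zero] at h1
  have hh : ‖h‖ₑ = 0 := by
    refine h.enorm_eq_zero_of_isCompact fun D hD => le_antisymm (ge_of_tendsto hlim0 ?_) zero_le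
    obtain ⟨C, hC, hCD⟩ := hk.exists_left D hD
    filter_upwards [h𝓤 hC.compl_mem_cocompact] with y hy
    rw [OrliczSpace.enorm_eq_of_rep (f := h - G y) (ae_of_all _ fun _ => rfl)]
    refine orliczNorm_mono ?_
    filter_upwards [OrliczSpace.rep_sub h (G y),
      mul_rep_normalizedTranslate (H := H) (P := P) (μ := μ) hw hg hgc y] with x h1 h2
    by_cases hx : x ∈ D
    · rw [Set.indicator_of_mem hx, h1, Pi.sub_apply, mul_sub, h2, hCD x hx y hy, sub_zero]
    · rw [Set.indicator_of_notMem hx, norm_zero]; exact norm_nonneg _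
  rw [← hh]
  exact hlim.enorm

end

end Hypergroup

end

theorem mainTheorem5 {K : Type*} [TopologicalSpace K] [T2Space K] [LocallyCompactSpace K]
    [MeasurableSpace K] [BorelSpace K] (H : Hypergroup K)
    (lam : Measure K) [lam.Regular] (hlam : H.IsLeftInvariant lam)
    (w : C(K, ℝ)) (hw : H.IsWeight w)
    (P : YoungPair) (hΨ : DeltaTwo P.Ψ)
    (g : K → ℂ) (hg : Continuous g) (hgc : HasCompactSupport g) :
    (∃ T : WeightedL1 lam w →L[ℂ] OrliczSpace P lam w,
      (∀ f : WeightedL1 lam w, ∀ᵐ x ∂lam,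
        H.ConvExistsAt lam f g x ∧ (T f).rep x = H.conv lam f g x) ∧
      IsCompactOperator T) ↔
    Tendsto (fun x : K =>
        orliczNorm P lam (fun y => (w y : ℂ) * H.leftTranslate x g y) / ENNReal.ofReal (w x))
      (cocompact K) (𝓝 0) := by
  simp only [← Hypergroup.orliczNorm_weightedKernel hw.pos]
  constructor
  · rintro ⟨T, hT, hTc⟩
    rcases eq_or_ne lam 0 with rfl | h0
    · simpa [orliczNorm] using tendsto_const_nhds
    · have := hlam.isOpenPosMeasure h0
      exact Hypergroup.tendsto_of_isCompactOperator hw.pos hg hgc T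
        (fun f => (hT f).mono fun x hx => hx.2) hTc
  · intro h
    obtain ⟨C, hC, hC1⟩ := mem_cocompact.1 (h.eventually_le_const one_pos)
    obtain ⟨M, hM, hCM⟩ := (Hypergroup.isProperKernel_weightedKernel (H := H) hw.pos hg
      hgc).exists_orliczNorm_le_of_isCompact P (μ := lam) hC
    have hM' : ∀ y, orliczNorm P lam (H.weightedKernel w g y) ≤ max M 1 := fun y => by
      by_cases hy : y ∈ C
      · exact (hCM y hy).trans (le_max_left _ _)
      · exact le_max_of_le_right (hC1 hy)
    obtain ⟨T, hT⟩ := Hypergroup.exists_convolution_operator hw.pos hg hgc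
      (max_lt hM.lt_top ENNReal.one_lt_top).ne hM'
    refine ⟨T, fun f => (hT f).mono fun x hx => ⟨?_, hx⟩,
      Hypergroup.isCompactOperator_of_tendsto hw.pos hg hgc h T hT⟩
    exact Hypergroup.convExistsAt hw.pos hg hgc (WeightedL1.integrable hw.pos f) x
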